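/- Let $n\ge 2$, write points of $\mathbb{R}^n$ as $x=(x_1,x')\in\mathbb{R}\times\mathbb{R}^{n-1}$, and let $\Omega=\{x\in\mathbb{R}^n:-\pi<x_1<\pi\}$. Let $K:\mathbb{R}^n\to(0,+\infty)$ be a (Lebesgue) measurable function such that - $K(x_1,Rx')=K(x_1,x')$ for all $(x_1,x')\in\mathbb{R}^n$ and all $R\in \mathrm{O}(n-1)$; - for every $x_1\in\mathbb{R}$, $K(x_1,x')$ is strictly decreasing in $|x'|\in(0,+\infty)$, that is, $K(x_1,y')<K(x_1,x')$ whenever $0<|x'|<|y'|$; - $K(x_1,\cdot)\in L^1(\mathbb{R}^{n-1})$ for every $x_1\in\mathbb{R}\setminus\{0\}$. For a (Lebesgue) measurable set $E\subset\mathbb{R}^n$ define $$\mathcal{P}_K[E]=\int_{E\cap\Omega}\left(\int_{\mathbb{R}^n\setminus E}K(x-y)\,dy\right)dx\in[0,+\infty],$$ and let $E^{*\mathrm{cyl}}\subset\mathbb{R}^n$ be the cylindrical rearrangement of $E$, i.e. the set such that, for every $x_1\in\mathbb{R}$, the section $\{x'\in\mathbb{R}^{n-1}:(x_1,x')\in E^{*\mathrm{cyl}}\}$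 is the open ball of $\mathbb{R}^{n-1}$ centered at $0$ with the same $(n-1)$-dimensional Lebesgue (outer) measure as $E_{x_1}=\{x'\in\mathbb{R}^{n-1}:(x_1,x')\in E\}$ (empty if this measure is $0$, and all of $\mathbb{R}^{n-1}$ if it is $+\infty$). Let $E\subset\mathbb{R}^n$ be a measurable set with $|E\cap\Omega|<+\infty$. Then $$\mathcal{P}_K[E^{*\mathrm{cyl}}]\le\mathcal{P}_K[E].$$ Moreover, if $|E\cap\Omega|>0$ and $\mathcal{P}_K[E]<+\infty$, then $\mathcal{P}_K[E^{*\mathrm{cyl}}]=\mathcal{P}_K[E]$ if and only if there is $c\in\mathbb{R}^{n-1}$ such that $E=E^{*\mathrm{cyl}}+(0,c)$ up to a set of $n$-dimensional Lebesgue measure zero. -/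

import Mathlib

open MeasureTheory
open scoped ENNReal

noncomputable section

/-- The transversal space `ℝ^{n-1}`, with its Euclidean norm and Lebesgue measure. -/
abbrev Transversal (n : ℕ) : Type := EuclideanSpace ℝ (Fin (n - 1))

/-- `ℝ^n`, written as `ℝ × ℝ^{n-1}` with points `x = (x₁, x')`; `volume` is the (product)
`n`-dimensional Lebesgue measure. -/
abbrev CylSpace (n : ℕ) : Type := ℝ × Transversal n

/-- The slab `Ω = {x ∈ ℝ^n : -π < x₁ < π}`. -/
def slab (n : ℕ) : Set (CylSpace n) := {x | -Real.pi < x.1 ∧ x.1 < Real.pi}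

/-- The transversal section `E_{x₁} = {x' : (x₁, x') ∈ E}`. -/
def transversalSection {n : ℕ} (E : Set (CylSpace n)) (x₁ : ℝ) : Set (Transversal n) :=
  {x' | (x₁, x') ∈ E}

/-- The radius `(|A| / |B₁|)^{1/d}`, which is that of the ball of `ℝ^d` with the measure of `A`
when `|A| < ∞`. -/
def schwarzRadius {d : ℕ} (A : Set (EuclideanSpace ℝ (Fin d))) : ℝ :=
  (volume A / volume (Metric.ball (0 : EuclideanSpace ℝ (Fin d)) 1)).toReal ^ (1 / (d : ℝ))

open Classical in
/-- The Schwarz rearrangement of `A ⊆ ℝ^d`: the open ball centered at `0` with the same Lebesgue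
measure as `A` (the empty set if `|A| = 0`, the whole space if `|A| = ∞`). -/
def schwarz {d : ℕ} (A : Set (EuclideanSpace ℝ (Fin d))) : Set (EuclideanSpace ℝ (Fin d)) :=
  if volume A = ∞ then Set.univ else Metric.ball 0 (schwarzRadius A)

/-- The Schwarz rearrangement preserves the Lebesgue measure. -/
theorem volume_schwarz {d : ℕ} (hd : 1 ≤ d) (A : Set (EuclideanSpace ℝ (Fin d))) :
    volume (schwarz A) = volume A := by
  have hd' : d ≠ 0 := by omega
  have : Nonempty (Fin d) := ⟨⟨0, hd⟩⟩
  unfold schwarz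
  split_ifs with h
  · rw [h]
    exact measure_univ_of_isAddLeftInvariant _
  · have hpos : volume (Metric.ball (0 : EuclideanSpace ℝ (Fin d)) 1) ≠ 0 :=
      (Metric.measure_ball_pos volume _ one_pos).ne'
    have hfin : volume (Metric.ball (0 : EuclideanSpace ℝ (Fin d)) 1) ≠ ∞ :=
      measure_ball_lt_top.ne
    have hq : volume A / volume (Metric.ball (0 : EuclideanSpace ℝ (Fin d)) 1) ≠ ∞ :=
      ENNReal.div_ne_top h hpos
    have hr : 0 ≤ schwarzRadius A := Real.rpow_nonneg ENNReal.toReal_nonneg _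
    rw [Measure.addHaar_ball _ _ hr, finrank_euclideanSpace, Fintype.card_fin]
    have hp : schwarzRadius A ^ d
        = (volume A / volume (Metric.ball (0 : EuclideanSpace ℝ (Fin d)) 1)).toReal := by
      unfold schwarzRadius
      rw [one_div, Real.rpow_inv_natCast_pow ENNReal.toReal_nonneg hd']
    rw [hp, ENNReal.ofReal_toReal hq, ENNReal.div_mul_cancel hpos hfin]

/-- The cylindrical rearrangement `E^{*cyl}` of `E`: the set whose transversal section at each
`x₁` is the Schwarz rearrangement of `E_{x₁}`. -/
def cylRearrangement {n : ℕ} (E : Set (CylSpace n)) : Set (CylSpace n) :=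
  {x | x.2 ∈ schwarz (transversalSection E x.1)}

/-- The periodic anisotropic nonlocal perimeter
`P_K[E] = ∫_{x ∈ E ∩ Ω} ∫_{y ∈ E^c} K(x - y) dy dx ∈ [0, ∞]`. -/
def periodicPerimeter {n : ℕ} (K : CylSpace n → ℝ) (E : Set (CylSpace n)) : ℝ≥0∞ :=
  ∫⁻ x in E ∩ slab n, ∫⁻ y in Eᶜ, ENNReal.ofReal (K (x - y))

/-- `K(x₁, R x') = K(x₁, x')` for every `R ∈ O(n-1)`. -/
def RotInvariant {n : ℕ} (K : CylSpace n → ℝ) : Prop :=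
  ∀ (R : Transversal n ≃ₗᵢ[ℝ] Transversal n) (x₁ : ℝ) (x' : Transversal n),
    K (x₁, R x') = K (x₁, x')

/-- For every `x₁`, `K(x₁, x')` is (strictly) decreasing in `|x'| ∈ (0, ∞)`. -/
def RadiallyDecreasing {n : ℕ} (K : CylSpace n → ℝ) : Prop :=
  ∀ (x₁ : ℝ) (x' y' : Transversal n), 0 < ‖x'‖ → ‖x'‖ < ‖y'‖ → K (x₁, y') < K (x₁, x')

end

/-!
The perimeter is an integral over pairs `(x₁, y₁)` of the interaction, through the kernel `K (x₁ -
y₁, ·)`, of the cross section of `E` at `x₁` with the complement of the cross section at `y₁`. Since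
the kernel is integrable for `x₁ ≠ y₁`, this interaction is `‖K (x₁ - y₁, ·)‖₁` times the measure of
the first cross section minus the interaction of the two cross sections themselves, so that the
theorem follows from Riesz's rearrangement inequality on `ℝ^{n-1}` for a fixed, strictly radially
decreasing kernel, together with its equality case. Both are proved with polarizations (two-point
rearrangements), which never decrease the interaction (`interaction_le_polarize`).

*Inequality* (`interaction_le_ball`). Averaging over all reflections shows that some polarization
moves a part of `A \ A*` into `A* \ A` whose measure is at least a constant times `|A \ A*| * |A* \
A|` (`exists_reflection_overlap`). Hence bounded sets are brought as close as desired to the balls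
`A*` and `B*` by polarizations (`exists_interaction_le_near_ball`). Monotone convergence removes the
boundedness of the sets and of the kernel.

*Equality* (`exists_ae_eq_ball_of_interaction_eq`). If the interaction of `A` and `B` is maximal, no
polarization increases it, and as the kernel is strictly decreasing, `A` and `B` have no unpaired
points on opposite sides of any hyperplane (`PolarizationAligned`). For a fixed direction, the
hyperplanes with unpaired points of `A` on a given side form an open set, and only one hyperplane
can be a mirror of a set of finite positive measure. By connectedness of the line, there is exactly
one mirror in each direction, common to `A` and `B`. All these mirrors pass through one point, the
centre of symmetry, and polarization with respect to the remaining hyperplanes shows at density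
points that `A` and `B` are balls around this centre.

In the equality case for `E`, almost every pair of cross sections is optimal. One nontrivial cross
section in the slab therefore fixes the centre of all the others.
-/

/-! ### Reflections across affine hyperplanes -/

section Reflection

variable {V : Type*} [NormedAddCommGroup V] [InnerProductSpace ℝ V]

/-- For a unit vector `u`, the reflection across the affine hyperplane `{x | ⟪u, x⟫ = t}`. -/
noncomputable def hyperplaneReflection (u : V) (t : ℝ) (x : V) : V :=
  x + (2 * (t - inner ℝ u x)) • u

theorem inner_hyperplaneReflection {u : V} (hu : ‖u‖ = 1) (t : ℝ) (x : V) :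
    inner ℝ u (hyperplaneReflection u t x) = 2 * t - inner ℝ u x := by
  simp only [hyperplaneReflection, inner_add_right, inner_smul_right,
    real_inner_self_eq_norm_sq, hu]
  ring

theorem hyperplaneReflection_involutive {u : V} (hu : ‖u‖ = 1) (t : ℝ) :
    Function.Involutive (hyperplaneReflection u t) := by
  intro x
  rw [hyperplaneReflection, inner_hyperplaneReflection hu, hyperplaneReflection, add_assoc,
    ← add_smul]
  ring_nf
  simp

theorem hyperplaneReflection_of_inner_eq {u : V} {t : ℝ} {x : V} (h : inner ℝ u x = t) :
    hyperplaneReflection u t x = x := by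
  simp [hyperplaneReflection, h]

theorem hyperplaneReflection_neg (u : V) (t : ℝ) :
    hyperplaneReflection (-u) (-t) = hyperplaneReflection u t := by
  funext x
  simp only [hyperplaneReflection, inner_neg_left, smul_neg, ← neg_smul]
  ring_nf

theorem continuous_hyperplaneReflection (u : V) :
    Continuous fun p : ℝ × V => hyperplaneReflection u p.1 p.2 := by
  unfold hyperplaneReflection
  fun_prop

/-- Two points on the same side of a hyperplane are closer to each other than to each other's
mirror images. -/
theorem norm_sub_hyperplaneReflection_sq {u : V} (hu : ‖u‖ = 1) (t : ℝ) (x y : V) :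
    ‖x - hyperplaneReflection u t y‖ ^ 2
      = ‖x - y‖ ^ 2 + 4 * (t - inner ℝ u x) * (t - inner ℝ u y) := by
  have h : x - hyperplaneReflection u t y = (x - y) - (2 * (t - inner ℝ u y)) • u := by
    rw [hyperplaneReflection]; abel
  rw [h, norm_sub_sq_real, inner_smul_right, real_inner_comm u (x - y), inner_sub_right,
    norm_smul, hu, Real.norm_eq_abs, mul_one, sq_abs]
  ring

theorem norm_hyperplaneReflection_sq {u : V} (hu : ‖u‖ = 1) (t : ℝ) (y : V) :
    ‖hyperplaneReflection u t y‖ ^ 2 = ‖y‖ ^ 2 + 4 * t * (t - inner ℝ u y) := by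
  have := norm_sub_hyperplaneReflection_sq hu t 0 y
  simpa using this

theorem dist_hyperplaneReflection {u : V} (hu : ‖u‖ = 1) (t : ℝ) (x y : V) :
    ‖hyperplaneReflection u t x - hyperplaneReflection u t y‖ = ‖x - y‖ := by
  rw [← sq_eq_sq₀ (norm_nonneg _) (norm_nonneg _), norm_sub_hyperplaneReflection_sq hu,
    inner_hyperplaneReflection hu, norm_sub_rev, norm_sub_hyperplaneReflection_sq hu, norm_sub_rev]
  ring

/-- A point on the other side of the hyperplane than `0` has a mirror image closer to `0`. -/
theorem norm_hyperplaneReflection_lt_iff {u : V} (hu : ‖u‖ = 1) {t : ℝ} (ht : 0 < t) (y : V) :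
    ‖hyperplaneReflection u t y‖ < ‖y‖ ↔ t < inner ℝ u y := by
  rw [← sq_lt_sq₀ (norm_nonneg _) (norm_nonneg _), norm_hyperplaneReflection_sq hu]
  constructor
  · intro h
    by_contra! h'
    have : 0 ≤ 4 * t * (t - inner ℝ u y) := by
      have : 0 ≤ t - inner ℝ u y := by linarith
      positivity
    linarith
  · intro h
    nlinarith

/-- The reflection across the perpendicular bisector of `x` and `y` exchanges `x` and `y`. -/
theorem hyperplaneReflection_bisector {x y : V} (hxy : x ≠ y) :
    hyperplaneReflection (‖x - y‖⁻¹ • (x - y)) ((‖x‖ ^ 2 - ‖y‖ ^ 2) / (2 * ‖x - y‖)) x = y := by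
  have h0 : ‖x - y‖ ≠ 0 := by simpa [sub_eq_zero] using hxy
  have h1 : inner ℝ (x - y) x = (‖x - y‖ ^ 2 + ‖x‖ ^ 2 - ‖y‖ ^ 2) / 2 := by
    rw [norm_sub_sq_real, inner_sub_left, real_inner_self_eq_norm_sq, real_inner_comm]
    ring
  rw [hyperplaneReflection, inner_smul_left, h1, smul_smul]
  have : 2 * ((‖x‖ ^ 2 - ‖y‖ ^ 2) / (2 * ‖x - y‖)
      - (starRingEnd ℝ) ‖x - y‖⁻¹ * ((‖x - y‖ ^ 2 + ‖x‖ ^ 2 - ‖y‖ ^ 2) / 2)) * ‖x - y‖⁻¹ = -1 := by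
    simp only [conj_trivial]
    field_simp
    ring
  rw [this]
  simp

variable [MeasurableSpace V] [BorelSpace V]

theorem measurable_hyperplaneReflection (u : V) (t : ℝ) :
    Measurable (hyperplaneReflection u t) :=
  ((continuous_hyperplaneReflection u).comp (Continuous.prodMk_right t)).measurable

theorem measurableEmbedding_hyperplaneReflection {u : V} (hu : ‖u‖ = 1) (t : ℝ) :
    MeasurableEmbedding (hyperplaneReflection u t) :=
  (MeasurableEquiv.ofInvolutive _ (hyperplaneReflection_involutive hu t)
    (measurable_hyperplaneReflection u t)).measurableEmbedding

variable [FiniteDimensional ℝ V]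

theorem measurePreserving_hyperplaneReflection {u : V} (hu : ‖u‖ = 1) (t : ℝ) :
    MeasurePreserving (hyperplaneReflection u t) volume volume := by
  have h1 := (Submodule.reflection (ℝ ∙ u)ᗮ).measurePreserving
  have h2 := measurePreserving_add_right (volume : Measure V) ((2 * t) • u)
  have h3 : hyperplaneReflection u t
      = (fun x => x + (2 * t) • u) ∘ (Submodule.reflection (ℝ ∙ u)ᗮ) := by
    funext x
    simp only [Function.comp, Submodule.reflection_orthogonal_apply,
      Submodule.reflection_singleton_apply, hu, hyperplaneReflection]
    simp only [RCLike.ofReal_real_eq_id, id, one_pow, div_one, two_mul, add_smul, sub_smul,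
      two_smul]
    abel
  rw [h3]
  exact h2.comp h1

theorem volume_preimage_hyperplaneReflection {u : V} (hu : ‖u‖ = 1) (t : ℝ) (A : Set V) :
    volume (hyperplaneReflection u t ⁻¹' A) = volume A :=
  (measurePreserving_hyperplaneReflection hu t).measure_preimage_emb
    (measurableEmbedding_hyperplaneReflection hu t) A

end Reflection

/-! ### The interaction functional -/

section Interaction

variable {V : Type*} [NormedAddCommGroup V] [InnerProductSpace ℝ V]
  [FiniteDimensional ℝ V] [MeasurableSpace V] [BorelSpace V]

/-- The interaction `∫_A ∫_B g(|x - y|) dy dx` of two sets through the radial kernel with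
profile `g`. -/
noncomputable def interaction (g : ℝ → ℝ≥0∞) (A B : Set V) : ℝ≥0∞ :=
  ∫⁻ x in A, ∫⁻ y in B, g ‖x - y‖

theorem measurable_profile_norm_sub {g : ℝ → ℝ≥0∞} (hg : Antitone g) :
    Measurable fun p : V × V => g ‖p.1 - p.2‖ :=
  hg.measurable.comp (by fun_prop)

theorem measurable_setLIntegral_profile {g : ℝ → ℝ≥0∞} (hg : Antitone g) (B : Set V) :
    Measurable fun x : V => ∫⁻ y in B, g ‖x - y‖ :=
  (measurable_profile_norm_sub hg).lintegral_prod_right'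

theorem interaction_comm {g : ℝ → ℝ≥0∞} (hg : Antitone g) (A B : Set V) :
    interaction g A B = interaction g B A := by
  unfold interaction
  rw [lintegral_lintegral_swap (measurable_profile_norm_sub hg).aemeasurable]
  simp_rw [norm_sub_rev]

theorem interaction_union_left (g : ℝ → ℝ≥0∞) {A A' : Set V} (B : Set V)
    (hA' : MeasurableSet A') (h : Disjoint A A') :
    interaction g (A ∪ A') B = interaction g A B + interaction g A' B :=
  lintegral_union hA' h

theorem interaction_union_right {g : ℝ → ℝ≥0∞} (hg : Antitone g) (A : Set V) {B B' : Set V}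
    (hB' : MeasurableSet B') (h : Disjoint B B') :
    interaction g A (B ∪ B') = interaction g A B + interaction g A B' := by
  rw [interaction_comm hg, interaction_union_left g A hB' h, interaction_comm hg A,
    interaction_comm hg A]

theorem interaction_mono {g : ℝ → ℝ≥0∞} {A A' B B' : Set V} (hA : A ⊆ A') (hB : B ⊆ B') :
    interaction g A B ≤ interaction g A' B' :=
  (lintegral_mono_set hA).trans (lintegral_mono fun _ => lintegral_mono_set hB)

theorem interaction_preimage_right (g : ℝ → ℝ≥0∞) {u : V} (hu : ‖u‖ = 1) (t : ℝ) (A B : Set V) :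
    interaction g A (hyperplaneReflection u t ⁻¹' B)
      = ∫⁻ x in A, ∫⁻ y in B, g ‖x - hyperplaneReflection u t y‖ := by
  unfold interaction
  refine lintegral_congr fun x => ?_
  rw [← (measurePreserving_hyperplaneReflection hu t).setLIntegral_comp_preimage_emb
    (measurableEmbedding_hyperplaneReflection hu t) (fun y => g ‖x - hyperplaneReflection u t y‖)]
  simp_rw [hyperplaneReflection_involutive hu t _]

theorem interaction_preimage (g : ℝ → ℝ≥0∞) {u : V} (hu : ‖u‖ = 1) (t : ℝ) (A B : Set V) :
    interaction g (hyperplaneReflection u t ⁻¹' A) (hyperplaneReflection u t ⁻¹' B)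
      = interaction g A B := by
  rw [interaction_preimage_right g hu, interaction,
    ← (measurePreserving_hyperplaneReflection hu t).setLIntegral_comp_preimage_emb
    (measurableEmbedding_hyperplaneReflection hu t) (fun x => ∫⁻ y in B, g ‖x - y‖)]
  refine lintegral_congr fun x => lintegral_congr fun y => ?_
  rw [← dist_hyperplaneReflection hu t x, hyperplaneReflection_involutive hu t _]

theorem interaction_preimage_left {g : ℝ → ℝ≥0∞} {u : V} (hu : ‖u‖ = 1) (t : ℝ)
    (A B : Set V) : interaction g (hyperplaneReflection u t ⁻¹' A) B
      = interaction g A (hyperplaneReflection u t ⁻¹' B) := by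
  rw [← interaction_preimage g hu t A, ← Set.preimage_comp,
    (hyperplaneReflection_involutive hu t).comp_self, Set.preimage_id]

/-- Reflecting one of two sets to the other side of a hyperplane lowers their interaction. -/
theorem interaction_preimage_right_le {g : ℝ → ℝ≥0∞} (hg : Antitone g) {u : V} (hu : ‖u‖ = 1)
    {t : ℝ} {X Y : Set V} (hXm : MeasurableSet X) (hYm : MeasurableSet Y)
    (hX : ∀ x ∈ X, inner ℝ u x < t) (hY : ∀ y ∈ Y, inner ℝ u y < t) :
    interaction g X (hyperplaneReflection u t ⁻¹' Y) ≤ interaction g X Y := by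
  rw [interaction_preimage_right g hu]
  refine setLIntegral_mono' hXm fun x hx => setLIntegral_mono' hYm fun y hy => hg ?_
  rw [← sq_le_sq₀ (norm_nonneg _) (norm_nonneg _), norm_sub_hyperplaneReflection_sq hu]
  nlinarith [hX x hx, hY y hy, mul_pos (sub_pos.2 (hX x hx)) (sub_pos.2 (hY y hy))]

theorem interaction_preimage_right_lt {g : ℝ → ℝ≥0∞} (hg : Antitone g)
    (hgs : StrictAntiOn g (Set.Ici 0)) {u : V} (hu : ‖u‖ = 1)
    {t : ℝ} {X Y : Set V} (hXm : MeasurableSet X) (hYm : MeasurableSet Y)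
    (hX : ∀ x ∈ X, inner ℝ u x < t) (hY : ∀ y ∈ Y, inner ℝ u y < t)
    (hX0 : volume X ≠ 0) (hY0 : volume Y ≠ 0) (hfin : interaction g X Y ≠ ∞) :
    interaction g X (hyperplaneReflection u t ⁻¹' Y) < interaction g X Y := by
  rw [interaction_preimage_right g hu]
  have hlt : ∀ x ∈ X, ∀ y ∈ Y, g ‖x - hyperplaneReflection u t y‖ < g ‖x - y‖ := by
    intro x hx y hy
    refine hgs (norm_nonneg _) (norm_nonneg _) ?_
    rw [← sq_lt_sq₀ (norm_nonneg _) (norm_nonneg _), norm_sub_hyperplaneReflection_sq hu]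
    nlinarith [mul_pos (sub_pos.2 (hX x hx)) (sub_pos.2 (hY y hy))]
  have hle : ∀ x ∈ X, ∫⁻ y in Y, g ‖x - hyperplaneReflection u t y‖ ≤ ∫⁻ y in Y, g ‖x - y‖ :=
    fun x hx => setLIntegral_mono' hYm fun y hy => (hlt x hx y hy).le
  have hm : Measurable fun x : V => ∫⁻ y in Y, g ‖x - hyperplaneReflection u t y‖ := by
    refine Measurable.lintegral_prod_right' (f := fun p : V × V =>
      g ‖p.1 - hyperplaneReflection u t p.2‖) ?_
    exact hg.measurable.comp
      (measurable_fst.sub ((measurable_hyperplaneReflection u t).comp measurable_snd)).norm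
  have hlef : ∫⁻ x in X, ∫⁻ y in Y, g ‖x - hyperplaneReflection u t y‖ ≠ ∞ :=
    ne_top_of_le_ne_top hfin (setLIntegral_mono' hXm hle)
  have hae : ∀ᵐ x ∂(volume.restrict X), ∫⁻ y in Y, g ‖x - y‖ < ∞ :=
    ae_lt_top (measurable_setLIntegral_profile hg Y) hfin
  refine lintegral_strict_mono (by simpa using hX0)
    (measurable_setLIntegral_profile hg Y).aemeasurable hlef ?_
  filter_upwards [hae, ae_restrict_mem hXm] with x hx hxX
  refine lintegral_strict_mono (by simpa using hY0) ?_ ?_ ?_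
  · exact ((measurable_profile_norm_sub hg).comp measurable_prodMk_left).aemeasurable
  · exact ne_top_of_le_ne_top hx.ne (hle x hxX)
  · filter_upwards [ae_restrict_mem hYm] with y hy using hlt x hxX y hy

end Interaction

/-! ### Polarization -/

section Polarization

variable {V : Type*} [NormedAddCommGroup V] [InnerProductSpace ℝ V]

/-- The points of `A` in the open half-space `{x | ⟪u, x⟫ < t}` whose mirror image is not in `A`.
The corresponding points of the opposite half-space form `unpaired (-u) (-t) A`. -/
def unpaired (u : V) (t : ℝ) (A : Set V) : Set V :=
  {x | x ∈ A ∧ inner ℝ u x < t ∧ hyperplaneReflection u t x ∉ A}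

/-- The points of `A` whose mirror image is in `A`. -/
def paired (u : V) (t : ℝ) (A : Set V) : Set V := A ∩ hyperplaneReflection u t ⁻¹' A

/-- The polarization (two-point rearrangement) of `A` towards the half-space `{x | ⟪u, x⟫ < t}`:
the points of `A` on the other side whose mirror image is not in `A` are reflected. -/
def polarize (u : V) (t : ℝ) (A : Set V) : Set V :=
  paired u t A ∪ unpaired u t A ∪ hyperplaneReflection u t ⁻¹' unpaired (-u) (-t) A

theorem mem_unpaired_neg {u : V} {t : ℝ} {A : Set V} {x : V} :
    x ∈ unpaired (-u) (-t) A ↔ x ∈ A ∧ t < inner ℝ u x ∧ hyperplaneReflection u t x ∉ A := by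
  simp only [unpaired, hyperplaneReflection_neg, inner_neg_left, neg_lt_neg_iff, Set.mem_ofPred_eq]

theorem mem_preimage_unpaired_neg {u : V} (hu : ‖u‖ = 1) {t : ℝ} {A : Set V} {x : V} :
    x ∈ hyperplaneReflection u t ⁻¹' unpaired (-u) (-t) A
      ↔ hyperplaneReflection u t x ∈ A ∧ inner ℝ u x < t ∧ x ∉ A := by
  rw [Set.mem_preimage, mem_unpaired_neg, inner_hyperplaneReflection hu,
    hyperplaneReflection_involutive hu t x]
  constructor <;> rintro ⟨h1, h2, h3⟩ <;> exact ⟨h1, by linarith, h3⟩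

theorem paired_union_unpaired (u : V) (t : ℝ) (A : Set V) :
    paired u t A ∪ unpaired u t A ∪ unpaired (-u) (-t) A = A := by
  ext x
  simp only [Set.mem_union, mem_unpaired_neg]
  constructor
  · rintro ((h | h) | h) <;> exact h.1
  · intro h
    by_cases h1 : hyperplaneReflection u t x ∈ A
    · exact Or.inl (Or.inl ⟨h, h1⟩)
    · rcases lt_trichotomy (inner ℝ u x) t with h2 | h2 | h2
      · exact Or.inl (Or.inr ⟨h, h2, h1⟩)
      · exact absurd (by rwa [hyperplaneReflection_of_inner_eq h2]) h1
      · exact Or.inr ⟨h, h2, h1⟩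

theorem disjoint_paired_unpaired (u : V) (t : ℝ) (A : Set V) :
    Disjoint (paired u t A) (unpaired u t A) :=
  Set.disjoint_left.2 fun _ h h' => h'.2.2 h.2

theorem disjoint_union_unpaired_neg (u : V) (t : ℝ) (A : Set V) :
    Disjoint (paired u t A ∪ unpaired u t A) (unpaired (-u) (-t) A) := by
  refine Set.disjoint_left.2 fun x h h' => ?_
  rw [mem_unpaired_neg] at h'
  rcases h with h | h
  · exact h'.2.2 h.2
  · exact lt_asymm h.2.1 h'.2.1

theorem disjoint_union_preimage_unpaired_neg {u : V} (hu : ‖u‖ = 1) (t : ℝ) (A : Set V) :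
    Disjoint (paired u t A ∪ unpaired u t A)
      (hyperplaneReflection u t ⁻¹' unpaired (-u) (-t) A) := by
  refine Set.disjoint_left.2 fun x h h' => ?_
  rw [mem_preimage_unpaired_neg hu] at h'
  rcases h with h | h <;> exact h'.2.2 h.1

theorem preimage_paired {u : V} (hu : ‖u‖ = 1) (t : ℝ) (A : Set V) :
    hyperplaneReflection u t ⁻¹' paired u t A = paired u t A := by
  ext x
  simp [paired, hyperplaneReflection_involutive hu t x, and_comm]

variable [MeasurableSpace V] [BorelSpace V]

theorem measurableSet_paired (u : V) (t : ℝ) {A : Set V} (hA : MeasurableSet A) :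
    MeasurableSet (paired u t A) :=
  hA.inter (measurable_hyperplaneReflection u t hA)

theorem measurableSet_unpaired (u : V) (t : ℝ) {A : Set V} (hA : MeasurableSet A) :
    MeasurableSet (unpaired u t A) := by
  have h : IsOpen {x : V | inner ℝ u x < t} := isOpen_lt (by fun_prop) continuous_const
  exact hA.inter (h.measurableSet.inter (measurable_hyperplaneReflection u t hA).compl)

theorem measurableSet_polarize (u : V) (t : ℝ) {A : Set V} (hA : MeasurableSet A) :
    MeasurableSet (polarize u t A) :=
  ((measurableSet_paired u t hA).union (measurableSet_unpaired u t hA)).union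
    (measurable_hyperplaneReflection u t (measurableSet_unpaired (-u) (-t) hA))

variable [FiniteDimensional ℝ V]

theorem volume_polarize {u : V} (hu : ‖u‖ = 1) (t : ℝ) {A : Set V} (hA : MeasurableSet A) :
    volume (polarize u t A) = volume A := by
  have hN := measurableSet_unpaired (-u) (-t) hA
  conv_rhs => rw [← paired_union_unpaired u t A]
  rw [measure_union (disjoint_union_unpaired_neg u t A) hN, polarize,
    measure_union (disjoint_union_preimage_unpaired_neg hu t A)
      (measurable_hyperplaneReflection u t hN), volume_preimage_hyperplaneReflection hu]

/-- The terms of the interaction of two sets and of their polarizations. The second and the third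
summand on the right-hand sides are the only ones that polarization changes. -/
theorem exists_interaction_eq_add {g : ℝ → ℝ≥0∞} (hg : Antitone g) {u : V} (hu : ‖u‖ = 1) (t : ℝ)
    {A B : Set V} (hA : MeasurableSet A) (hB : MeasurableSet B) :
    ∃ c : ℝ≥0∞,
      interaction g A B = c + interaction g (unpaired u t A) (unpaired (-u) (-t) B)
        + interaction g (unpaired (-u) (-t) A) (unpaired u t B) ∧
      interaction g (polarize u t A) (polarize u t B)
        = c + interaction g (unpaired u t A)
            (hyperplaneReflection u t ⁻¹' unpaired (-u) (-t) B)
          + interaction g (hyperplaneReflection u t ⁻¹' unpaired (-u) (-t) A)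
            (unpaired u t B) := by
  have hNA := measurableSet_unpaired (-u) (-t) hA
  have hNB := measurableSet_unpaired (-u) (-t) hB
  have hPA := measurableSet_unpaired u t hA
  have hPB := measurableSet_unpaired u t hB
  have hNA' := measurable_hyperplaneReflection u t hNA
  have hNB' := measurable_hyperplaneReflection u t hNB
  have e1 : interaction g A B = interaction g (paired u t A ∪ unpaired u t A ∪ unpaired (-u) (-t) A)
      (paired u t B ∪ unpaired u t B ∪ unpaired (-u) (-t) B) := by
    rw [paired_union_unpaired, paired_union_unpaired]
  refine ⟨interaction g (paired u t A) (paired u t B)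
    + interaction g (paired u t A) (unpaired u t B)
    + interaction g (paired u t A) (unpaired (-u) (-t) B)
    + interaction g (unpaired u t A) (paired u t B)
    + interaction g (unpaired u t A) (unpaired u t B)
    + interaction g (unpaired (-u) (-t) A) (paired u t B)
    + interaction g (unpaired (-u) (-t) A) (unpaired (-u) (-t) B), ?_, ?_⟩
  · rw [e1, interaction_union_left g _ hNA (disjoint_union_unpaired_neg u t A),
      interaction_union_left g _ hPA (disjoint_paired_unpaired u t A)]
    simp only [interaction_union_right hg _ hNB (disjoint_union_unpaired_neg u t B),
      interaction_union_right hg _ hPB (disjoint_paired_unpaired u t B)]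
    ring
  · rw [polarize, polarize,
      interaction_union_left g _ hNA' (disjoint_union_preimage_unpaired_neg hu t A),
      interaction_union_left g _ hPA (disjoint_paired_unpaired u t A)]
    simp only [interaction_union_right hg _ hNB' (disjoint_union_preimage_unpaired_neg hu t B),
      interaction_union_right hg _ hPB (disjoint_paired_unpaired u t B), interaction_preimage g hu]
    rw [← interaction_preimage_left hu t (paired u t A),
      interaction_preimage_left hu t _ (paired u t B), preimage_paired hu, preimage_paired hu]
    ring

theorem interaction_unpaired_le {g : ℝ → ℝ≥0∞} (hg : Antitone g) {u : V} (hu : ‖u‖ = 1) (t : ℝ)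
    {A B : Set V} (hA : MeasurableSet A) (hB : MeasurableSet B) :
    interaction g (unpaired u t A) (unpaired (-u) (-t) B)
      ≤ interaction g (unpaired u t A) (hyperplaneReflection u t ⁻¹' unpaired (-u) (-t) B) := by
  have := interaction_preimage_right_le hg hu (t := t) (measurableSet_unpaired u t hA)
    (measurable_hyperplaneReflection u t (measurableSet_unpaired (-u) (-t) hB))
    (fun x hx => hx.2.1) (fun y hy => ((mem_preimage_unpaired_neg hu).1 hy).2.1)
  rwa [← Set.preimage_comp, (hyperplaneReflection_involutive hu t).comp_self,
    Set.preimage_id] at this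

theorem interaction_unpaired_le' {g : ℝ → ℝ≥0∞} (hg : Antitone g) {u : V} (hu : ‖u‖ = 1) (t : ℝ)
    {A B : Set V} (hA : MeasurableSet A) (hB : MeasurableSet B) :
    interaction g (unpaired (-u) (-t) A) (unpaired u t B)
      ≤ interaction g (hyperplaneReflection u t ⁻¹' unpaired (-u) (-t) A) (unpaired u t B) := by
  rw [interaction_comm hg, interaction_comm hg _ (unpaired u t B)]
  exact interaction_unpaired_le hg hu t hB hA

/-- Polarization increases the interaction. -/
theorem interaction_le_polarize {g : ℝ → ℝ≥0∞} (hg : Antitone g) {u : V} (hu : ‖u‖ = 1) (t : ℝ)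
    {A B : Set V} (hA : MeasurableSet A) (hB : MeasurableSet B) :
    interaction g A B ≤ interaction g (polarize u t A) (polarize u t B) := by
  obtain ⟨c, h1, h2⟩ := exists_interaction_eq_add hg hu t hA hB
  rw [h1, h2]
  gcongr
  · exact interaction_unpaired_le hg hu t hA hB
  · exact interaction_unpaired_le' hg hu t hA hB

/-- If polarization does not increase the interaction, then `A` and `B` do not have unpaired points
on opposite sides of the hyperplane. -/
theorem volume_unpaired_eq_zero_or {g : ℝ → ℝ≥0∞} (hg : Antitone g)
    (hgs : StrictAntiOn g (Set.Ici 0)) {u : V} (hu : ‖u‖ = 1) (t : ℝ)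
    {A B : Set V} (hA : MeasurableSet A) (hB : MeasurableSet B)
    (hfin : interaction g A B ≠ ∞)
    (hle : interaction g (polarize u t A) (polarize u t B) ≤ interaction g A B) :
    volume (unpaired u t A) = 0 ∨ volume (unpaired (-u) (-t) B) = 0 := by
  by_contra! hne
  obtain ⟨c, h1, h2⟩ := exists_interaction_eq_add hg hu t hA hB
  have hfin' := ne_top_of_le_ne_top hfin hle
  have hlt : interaction g (unpaired u t A) (unpaired (-u) (-t) B)
      < interaction g (unpaired u t A) (hyperplaneReflection u t ⁻¹' unpaired (-u) (-t) B) := by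
    have := interaction_preimage_right_lt hg hgs hu (t := t) (measurableSet_unpaired u t hA)
      (measurable_hyperplaneReflection u t (measurableSet_unpaired (-u) (-t) hB))
      (fun x hx => hx.2.1) (fun y hy => ((mem_preimage_unpaired_neg hu).1 hy).2.1) hne.1
      (by rw [volume_preimage_hyperplaneReflection hu]; exact hne.2) ?_
    · rwa [← Set.preimage_comp, (hyperplaneReflection_involutive hu t).comp_self,
        Set.preimage_id] at this
    · refine ne_top_of_le_ne_top hfin' ?_
      rw [h2]
      exact le_add_right le_add_self
  rw [h1] at hfin
  rw [h1, h2] at hle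
  refine absurd hle (not_le.2 ?_)
  refine ENNReal.add_lt_add_of_lt_of_le ?_ (ENNReal.add_lt_add_left ?_ hlt)
    (interaction_unpaired_le' hg hu t hA hB)
  · exact (ENNReal.add_ne_top.1 hfin).2
  · exact (ENNReal.add_ne_top.1 (ENNReal.add_ne_top.1 hfin).1).1

end Polarization

/-! ### Averaging over all reflections -/

section Averaging

theorem lintegral_comp_add_smul {W : Type*} [NormedAddCommGroup W] [NormedSpace ℝ W]
    [MeasurableSpace W] [BorelSpace W] [FiniteDimensional ℝ W] (μ : Measure W) [μ.IsAddHaarMeasure]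
    {f : W → ℝ≥0∞} (hf : Measurable f) (a : W) {r : ℝ} (hr : r ≠ 0) :
    ∫⁻ x, f (a + r • x) ∂μ
      = ENNReal.ofReal |(r ^ Module.finrank ℝ W)⁻¹| * ∫⁻ x, f x ∂μ := by
  rw [← smul_eq_mul, ← lintegral_smul_measure, ← Measure.map_addHaar_smul μ hr,
    lintegral_map hf (measurable_const_smul r),
    ← lintegral_add_left_eq_self (μ := μ) (fun x => f (r • x)) (r⁻¹ • a)]
  simp [smul_add, smul_smul, hr]

variable {V : Type*} [NormedAddCommGroup V] [InnerProductSpace ℝ V]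
  [MeasurableSpace V] [BorelSpace V]

/-- For directions `w` of length at least one, the mirror images of a fixed point `x` in all
hyperplanes orthogonal to `w` sweep out the line through `x` in the direction `w`. -/
theorem lintegral_line_le {R : ℝ} {x w : V} (hx : ‖x‖ ≤ R) (hw : 1 ≤ ‖w‖) {Y : Set V}
    (hYm : MeasurableSet Y) (hY : ∀ y ∈ Y, ‖y‖ ≤ R) :
    ENNReal.ofReal (1 / 2) * ∫⁻ s in Set.Ioi (0 : ℝ), Y.indicator 1 (x + s • w)
      ≤ ∫⁻ t in Set.Icc (-R) R, Y.indicator 1 (hyperplaneReflection (‖w‖⁻¹ • w) t x) := by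
  have hw0 : 0 < ‖w‖ := by linarith
  have hu : ‖‖w‖⁻¹ • w‖ = 1 := by rw [norm_smul, norm_inv, norm_norm, inv_mul_cancel₀ hw0.ne']
  set u := ‖w‖⁻¹ • w with hudef
  have hm : Measurable fun t : ℝ => Y.indicator (1 : V → ℝ≥0∞) (hyperplaneReflection u t x) :=
    (measurable_one.indicator hYm).comp
      ((continuous_hyperplaneReflection u).comp (Continuous.prodMk_left x)).measurable
  -- a reflection that maps `x` into `Y` has its hyperplane at distance at most `R` from `0`
  have h1 : ∫⁻ t in Set.Icc (-R) R, Y.indicator 1 (hyperplaneReflection u t x)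
      = ∫⁻ t, Y.indicator (1 : V → ℝ≥0∞) (hyperplaneReflection u t x) := by
    refine setLIntegral_eq_of_support_subset ?_ 
    intro t ht
    have hmem : hyperplaneReflection u t x ∈ Y := by
      by_contra h
      exact ht (by simp [h])
    have e := inner_hyperplaneReflection hu t x
    have b1 := abs_real_inner_le_norm u x
    have b2 := abs_real_inner_le_norm u (hyperplaneReflection u t x)
    have b3 := hY _ hmem
    rw [hu, one_mul, abs_le] at b1 b2
    constructor <;> linarith
  have h2 := lintegral_comp_add_smul volume hm (inner ℝ u x) (r := ‖w‖ / 2) (by positivity)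
  have h3 : ∀ s : ℝ, hyperplaneReflection u (inner ℝ u x + (‖w‖ / 2) • s) x = x + s • w := by
    intro s
    rw [hyperplaneReflection, hudef, smul_smul, smul_eq_mul]
    congr 2
    field_simp
    ring
  simp only [h3, Module.finrank_self, pow_one] at h2
  rw [h1]
  calc ENNReal.ofReal (1 / 2) * ∫⁻ s in Set.Ioi (0 : ℝ), Y.indicator 1 (x + s • w)
      ≤ ENNReal.ofReal (1 / 2) * ∫⁻ s : ℝ, Y.indicator 1 (x + s • w) := by
        gcongr; exact Measure.restrict_le_self
    _ = (ENNReal.ofReal (1 / 2) * ENNReal.ofReal |(‖w‖ / 2)⁻¹|)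
          * ∫⁻ t, Y.indicator (1 : V → ℝ≥0∞) (hyperplaneReflection u t x) := by
        rw [h2, mul_assoc]
    _ ≤ 1 * ∫⁻ t, Y.indicator (1 : V → ℝ≥0∞) (hyperplaneReflection u t x) := by
        gcongr
        rw [← ENNReal.ofReal_mul (by norm_num), ENNReal.ofReal_le_one, abs_of_pos (by positivity)]
        rw [inv_div]
        rw [div_mul_div_comm, div_le_one (by positivity)]
        linarith
    _ = _ := one_mul _

/-- Polar coordinates around `x`, in the form of a lower bound. -/
theorem le_lintegral_annulus [FiniteDimensional ℝ V] [Nontrivial V] {R : ℝ} {x : V}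
    (hx : ‖x‖ ≤ R) {Y : Set V} (hYm : MeasurableSet Y) (hY : ∀ y ∈ Y, ‖y‖ ≤ R) :
    ENNReal.ofReal (((2 * R) ^ (Module.finrank ℝ V - 1))⁻¹ / 2) * volume Y
      ≤ ∫⁻ w in {w : V | 1 ≤ ‖w‖ ∧ ‖w‖ ≤ 2}, ∫⁻ s in Set.Ioi (0 : ℝ),
          Y.indicator 1 (x + s • w) := by
  set d := Module.finrank ℝ V with hd
  have hd1 : d - 1 + 1 = d := Nat.sub_add_cancel Module.finrank_pos
  set D : Set V := {w : V | 1 ≤ ‖w‖ ∧ ‖w‖ ≤ 2} with hD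
  have hDm : MeasurableSet D :=
    ((isClosed_le continuous_const continuous_norm).inter
      (isClosed_le continuous_norm continuous_const)).measurableSet
  have hind : Measurable (Y.indicator (1 : V → ℝ≥0∞)) := measurable_one.indicator hYm
  have hswap : ∫⁻ w in D, ∫⁻ s in Set.Ioi (0 : ℝ), Y.indicator (1 : V → ℝ≥0∞) (x + s • w)
      = ∫⁻ s in Set.Ioi (0 : ℝ), ∫⁻ w in D, Y.indicator (1 : V → ℝ≥0∞) (x + s • w) := by
    refine lintegral_lintegral_swap (Measurable.aemeasurable ?_)
    exact hind.comp (by fun_prop)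
  have hscale : ∀ s ∈ Set.Ioi (0 : ℝ), ∫⁻ w in D, Y.indicator (1 : V → ℝ≥0∞) (x + s • w)
      = ∫⁻ y in Y, ENNReal.ofReal ((s ^ d)⁻¹) * D.indicator (1 : V → ℝ≥0∞) (s⁻¹ • (y - x)) := by
    intro s hs
    have hs' : (0 : ℝ) < s := hs
    have hm : Measurable fun y : V =>
        Y.indicator (1 : V → ℝ≥0∞) y * D.indicator (1 : V → ℝ≥0∞) (s⁻¹ • (y - x)) :=
      hind.mul ((measurable_one.indicator hDm).comp (by fun_prop))
    have h := lintegral_comp_add_smul volume hm x hs'.ne'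
    rw [abs_of_pos (by positivity)] at h
    have hDs : Measurable fun y : V => D.indicator (1 : V → ℝ≥0∞) (s⁻¹ • (y - x)) :=
      (measurable_one.indicator hDm).comp (by fun_prop)
    rw [lintegral_const_mul _ hDs,
      ← lintegral_indicator hYm, ← lintegral_indicator hDm]
    have e1 : ∀ y, Y.indicator (fun y => D.indicator (1 : V → ℝ≥0∞) (s⁻¹ • (y - x))) y
        = Y.indicator (1 : V → ℝ≥0∞) y * D.indicator (1 : V → ℝ≥0∞) (s⁻¹ • (y - x)) := by
      intro y; by_cases hy : y ∈ Y <;> simp [hy]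
    have e2 : ∀ w, D.indicator (fun w => Y.indicator (1 : V → ℝ≥0∞) (x + s • w)) w
        = Y.indicator (1 : V → ℝ≥0∞) (x + s • w)
          * D.indicator (1 : V → ℝ≥0∞) (s⁻¹ • (x + s • w - x)) := by
      intro w
      rw [add_sub_cancel_left, smul_smul, inv_mul_cancel₀ hs'.ne', one_smul]
      by_cases hw : w ∈ D <;> simp [hw]
    simp_rw [e1, e2]
    exact h
  rw [hswap, setLIntegral_congr_fun measurableSet_Ioi hscale, lintegral_lintegral_swap]
  · rw [← setLIntegral_const]
    refine setLIntegral_mono_ae' hYm ?_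
    have hne : ∀ᵐ y : V, y ≠ x := by simp [ae_iff]
    filter_upwards [hne] with y hyx hy
    have hr : 0 < ‖y - x‖ := norm_pos_iff.2 (sub_ne_zero.2 hyx)
    set r := ‖y - x‖ with hrdef
    have hr2 : r ≤ 2 * R := (norm_sub_le _ _).trans (by linarith [hY y hy])
    -- the scales `s` between `r / 2` and `r` alone give the bound
    calc ENNReal.ofReal (((2 * R) ^ (d - 1))⁻¹ / 2)
        ≤ ENNReal.ofReal ((r ^ d)⁻¹) * ENNReal.ofReal (r - r / 2) := by
          rw [← ENNReal.ofReal_mul (by positivity)]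
          refine ENNReal.ofReal_le_ofReal ?_
          have : (r ^ d)⁻¹ * (r - r / 2) = (r ^ (d - 1))⁻¹ / 2 := by
            rw [← hd1, Nat.add_sub_cancel, pow_succ]; field_simp; ring
          rw [this]
          gcongr
      _ = ∫⁻ s in Set.Icc (r / 2) r, ENNReal.ofReal ((r ^ d)⁻¹) := by
          rw [setLIntegral_const, Real.volume_Icc]
      _ ≤ ∫⁻ s in Set.Icc (r / 2) r,
            ENNReal.ofReal ((s ^ d)⁻¹) * D.indicator (1 : V → ℝ≥0∞) (s⁻¹ • (y - x)) := by
          refine setLIntegral_mono' measurableSet_Icc fun s hs => ?_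
          have hs0 : 0 < s := lt_of_lt_of_le (by positivity) hs.1
          have hmem : s⁻¹ • (y - x) ∈ D := by
            simp only [hD, Set.mem_ofPred_eq, norm_smul, norm_inv, Real.norm_eq_abs,
              abs_of_pos hs0, ← hrdef, inv_mul_eq_div]
            rw [le_div_iff₀ hs0, div_le_iff₀ hs0]
            constructor <;> linarith [hs.1, hs.2]
          rw [Set.indicator_of_mem hmem, Pi.one_apply, mul_one]
          refine ENNReal.ofReal_le_ofReal ?_
          gcongr
          exact hs.2
      _ ≤ _ := lintegral_mono_set fun s hs => lt_of_lt_of_le (by positivity : 0 < r / 2) hs.1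
  · refine Measurable.aemeasurable ?_
    refine Measurable.mul ?_ ((measurable_one.indicator hDm).comp ?_)
    · fun_prop
    · exact (measurable_fst.inv).smul (measurable_snd.sub_const x)

/-- Some reflection maps a part of `X` into `Y` whose measure is bounded below in terms of the
measures of `X` and `Y`: this holds on average over all hyperplanes that meet the ball of radius
`R`. -/
theorem exists_reflection_overlap (V : Type*) [NormedAddCommGroup V] [InnerProductSpace ℝ V]
    [FiniteDimensional ℝ V] [MeasurableSpace V] [BorelSpace V] [Nontrivial V] {R : ℝ} (hR : 0 < R) :
    ∃ c : ℝ≥0∞, c ≠ 0 ∧ ∀ X Y : Set V, MeasurableSet X → MeasurableSet Y →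
      (∀ x ∈ X, ‖x‖ ≤ R) → (∀ y ∈ Y, ‖y‖ ≤ R) → ∃ (u : V) (t : ℝ), ‖u‖ = 1 ∧
        c * (volume X * volume Y) ≤ volume (X ∩ hyperplaneReflection u t ⁻¹' Y) := by
  set D : Set V := {w : V | 1 ≤ ‖w‖ ∧ ‖w‖ ≤ 2} with hD
  have hDm : MeasurableSet D :=
    ((isClosed_le continuous_const continuous_norm).inter
      (isClosed_le continuous_norm continuous_const)).measurableSet
  have hDfin : volume D ≠ ∞ := by
    refine (lt_of_le_of_lt (measure_mono ?_) (measure_closedBall_lt_top (x := (0 : V)) (r := 2))).ne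
    intro w hw
    simpa using hw.2
  obtain ⟨u₀, hu₀⟩ : ∃ u : V, ‖u‖ = 1 := exists_norm_eq V zero_le_one
  set c₀ : ℝ≥0∞ := ENNReal.ofReal (1 / 2)
    * ENNReal.ofReal (((2 * R) ^ (Module.finrank ℝ V - 1))⁻¹ / 2) with hc₀
  have hc₀0 : c₀ ≠ 0 := by
    refine mul_ne_zero ?_ ?_ <;> rw [Ne, ENNReal.ofReal_eq_zero, not_le] <;> positivity
  have hc₀t : c₀ ≠ ∞ := ENNReal.mul_ne_top ENNReal.ofReal_ne_top ENNReal.ofReal_ne_top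
  set M : ℝ≥0∞ := volume D * ENNReal.ofReal (R - -R) with hM
  have hMt : M ≠ ∞ := ENNReal.mul_ne_top hDfin ENNReal.ofReal_ne_top
  refine ⟨c₀ / (2 * M), ENNReal.div_ne_zero.2 ⟨hc₀0, ENNReal.mul_ne_top (by simp) hMt⟩, ?_⟩
  intro X Y hXm hYm hX hY
  by_contra! hcon
  have hXY := (hcon u₀ 0 hu₀).ne_bot
  have hvt : volume X * volume Y ≠ ∞ := by
    have : ∀ Z : Set V, (∀ x ∈ Z, ‖x‖ ≤ R) → volume Z ≠ ∞ := fun Z hZ =>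
      ((measure_mono fun z hz => by simpa using hZ z hz).trans_lt
        (measure_closedBall_lt_top (x := (0 : V)) (r := R))).ne
    exact ENNReal.mul_ne_top (this X hX) (this Y hY)
  have hv0 : volume X * volume Y ≠ 0 := fun h => hXY (by simp [h])
  have hind : Measurable (Y.indicator (1 : V → ℝ≥0∞)) := measurable_one.indicator hYm
  have hmeas : Measurable fun p : (V × ℝ) × V =>
      Y.indicator (1 : V → ℝ≥0∞) (hyperplaneReflection (‖p.1.1‖⁻¹ • p.1.1) p.1.2 p.2) := by
    refine hind.comp ?_
    unfold hyperplaneReflection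
    fun_prop
  have hvol : ∀ (w : V) (t : ℝ), volume (X ∩ hyperplaneReflection (‖w‖⁻¹ • w) t ⁻¹' Y)
      = ∫⁻ x in X, Y.indicator 1 (hyperplaneReflection (‖w‖⁻¹ • w) t x) := by
    intro w t
    have hm := measurable_hyperplaneReflection (‖w‖⁻¹ • w) t hYm
    rw [Set.inter_comm, ← Measure.restrict_apply hm, ← lintegral_indicator_one hm]
    rfl
  have hlow : c₀ * (volume X * volume Y) ≤ ∫⁻ w in D, ∫⁻ t in Set.Icc (-R) R,
      volume (X ∩ hyperplaneReflection (‖w‖⁻¹ • w) t ⁻¹' Y) := by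
    simp_rw [hvol]
    have hsw : ∫⁻ w in D, ∫⁻ t in Set.Icc (-R) R, ∫⁻ x in X,
          Y.indicator (1 : V → ℝ≥0∞) (hyperplaneReflection (‖w‖⁻¹ • w) t x)
        = ∫⁻ x in X, ∫⁻ w in D, ∫⁻ t in Set.Icc (-R) R,
          Y.indicator (1 : V → ℝ≥0∞) (hyperplaneReflection (‖w‖⁻¹ • w) t x) := by
      rw [lintegral_lintegral_swap (α := V) (β := V)]
      · refine lintegral_congr fun w => lintegral_lintegral_swap (Measurable.aemeasurable ?_)
        exact hmeas.comp ((measurable_const.prodMk measurable_fst).prodMk measurable_snd)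
      · refine Measurable.aemeasurable (Measurable.lintegral_prod_right'
          (f := fun q : (V × V) × ℝ => Y.indicator (1 : V → ℝ≥0∞)
            (hyperplaneReflection (‖q.1.2‖⁻¹ • q.1.2) q.2 q.1.1)) ?_)
        exact hmeas.comp (((measurable_snd.comp measurable_fst).prodMk measurable_snd).prodMk
          (measurable_fst.comp measurable_fst))
    rw [hsw, mul_comm (volume X), ← mul_assoc, ← setLIntegral_const]
    refine setLIntegral_mono' hXm fun x hx => ?_
    calc c₀ * volume Y
        = ENNReal.ofReal (1 / 2) * (ENNReal.ofReal
            (((2 * R) ^ (Module.finrank ℝ V - 1))⁻¹ / 2) * volume Y) := by rw [hc₀, mul_assoc]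
      _ ≤ ENNReal.ofReal (1 / 2) * ∫⁻ w in D, ∫⁻ s in Set.Ioi (0 : ℝ),
            Y.indicator 1 (x + s • w) := by
          gcongr
          exact le_lintegral_annulus (hX x hx) hYm hY
      _ ≤ ∫⁻ w in D, ENNReal.ofReal (1 / 2) * ∫⁻ s in Set.Ioi (0 : ℝ),
            Y.indicator 1 (x + s • w) := lintegral_const_mul_le _ _
      _ ≤ _ := setLIntegral_mono' hDm fun w hw => lintegral_line_le (hX x hx) hw.1 hYm hY
  have hup : ∫⁻ w in D, ∫⁻ t in Set.Icc (-R) R,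
      volume (X ∩ hyperplaneReflection (‖w‖⁻¹ • w) t ⁻¹' Y)
        ≤ c₀ / (2 * M) * (volume X * volume Y) * M := by
    calc _ ≤ ∫⁻ w in D, ∫⁻ t in Set.Icc (-R) R, c₀ / (2 * M) * (volume X * volume Y) := by
          refine setLIntegral_mono' hDm fun w hw => lintegral_mono fun t => (hcon _ t ?_).le
          have hw0 : 0 < ‖w‖ := by linarith [hw.1]
          rw [norm_smul, norm_inv, norm_norm, inv_mul_cancel₀ hw0.ne']
      _ = _ := by
          simp only [setLIntegral_const, Real.volume_Icc, hM]
          ring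
  have htwice : 2 * (c₀ * (volume X * volume Y)) ≤ c₀ * (volume X * volume Y) := by
    calc 2 * (c₀ * (volume X * volume Y))
        ≤ 2 * (c₀ / (2 * M) * (volume X * volume Y) * M) := mul_le_mul' le_rfl (hlow.trans hup)
      _ = (2 * M) * (c₀ / (2 * M)) * (volume X * volume Y) := by ring
      _ ≤ c₀ * (volume X * volume Y) := by gcongr; exact ENNReal.mul_div_le
  have hz0 : c₀ * (volume X * volume Y) ≠ 0 := mul_ne_zero hc₀0 hv0
  have hzt : c₀ * (volume X * volume Y) ≠ ∞ := ENNReal.mul_ne_top hc₀t hvt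
  rw [two_mul] at htwice
  exact absurd htwice (not_le.2 (ENNReal.lt_add_right hzt hz0))

end Averaging

/-! ### The rearrangement inequality -/

section Riesz

variable {V : Type*} [NormedAddCommGroup V] [InnerProductSpace ℝ V]

theorem norm_le_of_mem_polarize {u : V} (hu : ‖u‖ = 1) {t : ℝ} (ht : 0 < t) {A : Set V} {R : ℝ}
    (hA : ∀ x ∈ A, ‖x‖ ≤ R) : ∀ x ∈ polarize u t A, ‖x‖ ≤ R := by
  rintro x ((h | h) | h)
  · exact hA x h.1
  · exact hA x h.1
  · rw [mem_preimage_unpaired_neg hu] at h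
    refine le_trans ?_ (hA _ h.1)
    by_contra! hlt
    exact lt_asymm h.2.1 ((norm_hyperplaneReflection_lt_iff hu ht x).1 hlt)

variable [FiniteDimensional ℝ V] [MeasurableSpace V] [BorelSpace V]

/-- Polarization towards a half-space containing `0` moves `A` closer to the ball `D` centered at
`0`: the points of `A` outside `D` with a mirror image in `D \ A` are moved into `D`. -/
theorem volume_polarize_diff_ball_add_le {u : V} (hu : ‖u‖ = 1) {t : ℝ} (ht : 0 < t) {A : Set V}
    (hA : MeasurableSet A) (r : ℝ) :
    volume (polarize u t A \ Metric.ball 0 r)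
      + volume ((A \ Metric.ball 0 r) ∩ hyperplaneReflection u t ⁻¹' (Metric.ball 0 r \ A))
      ≤ volume (A \ Metric.ball 0 r) := by
  set D : Set V := Metric.ball 0 r with hD
  have hDm : MeasurableSet D := measurableSet_ball
  set N := unpaired (-u) (-t) A with hN
  set S := paired u t A ∪ unpaired u t A with hS
  have hNm : MeasurableSet N := measurableSet_unpaired (-u) (-t) hA
  have hσD : MeasurableSet (hyperplaneReflection u t ⁻¹' D) :=
    measurable_hyperplaneReflection u t hDm
  have hlt : ∀ x ∈ N, ‖hyperplaneReflection u t x‖ < ‖x‖ := fun x hx =>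
    (norm_hyperplaneReflection_lt_iff hu ht x).2 (mem_unpaired_neg.1 hx).2.1
  have h1 : volume (polarize u t A \ D) ≤ volume (S \ D)
      + volume (N \ hyperplaneReflection u t ⁻¹' D) := by
    rw [polarize, Set.union_sdiff_distrib]
    refine (measure_union_le _ _).trans (add_le_add le_rfl (le_of_eq ?_))
    rw [← volume_preimage_hyperplaneReflection hu t, Set.preimage_sdiff, ← Set.preimage_comp,
      (hyperplaneReflection_involutive hu t).comp_self, Set.preimage_id]
  have h2 : volume (A \ D) = volume (S \ D) + volume (N \ D) := by
    conv_lhs => rw [← paired_union_unpaired u t A, Set.union_sdiff_distrib]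
    exact measure_union ((disjoint_union_unpaired_neg u t A).mono Set.sdiff_subset Set.sdiff_subset)
      (hNm.diff hDm)
  have h3 : volume (N \ hyperplaneReflection u t ⁻¹' D)
      + volume ((A \ D) ∩ hyperplaneReflection u t ⁻¹' (D \ A)) ≤ volume (N \ D) := by
    rw [← measure_union' (Set.disjoint_left.2 fun x hx hx' => hx.2 hx'.2.1) (hNm.diff hσD)]
    refine measure_mono ?_
    rintro x (⟨hx, hx'⟩ | ⟨⟨hxA, hxD⟩, hσ, hσA⟩)
    · refine ⟨hx, fun hxD => hx' ?_⟩
      have := hlt x hx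
      simp only [hD, Set.mem_preimage, mem_ball_zero_iff] at hxD ⊢
      linarith
    · refine ⟨mem_unpaired_neg.2 ⟨hxA, ?_, hσA⟩, hxD⟩
      rw [← norm_hyperplaneReflection_lt_iff hu ht]
      simp only [hD, mem_ball_zero_iff, not_lt] at hσ hxD
      linarith
  calc _ ≤ volume (S \ D) + volume (N \ hyperplaneReflection u t ⁻¹' D)
        + volume ((A \ D) ∩ hyperplaneReflection u t ⁻¹' (D \ A)) := by gcongr
    _ ≤ volume (S \ D) + volume (N \ D) := by rw [add_assoc]; gcongr
    _ = _ := h2.symm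

theorem volume_diff_eq_of_volume_eq {A D : Set V} (hA : MeasurableSet A) (hD : MeasurableSet D)
    (h : volume A = volume D) (hfin : volume D ≠ ∞) : volume (D \ A) = volume (A \ D) := by
  have h1 := measure_inter_add_sdiff (μ := volume) A hD
  have h2 := measure_inter_add_sdiff (μ := volume) D hA
  rw [← h, ← h1, Set.inter_comm D A] at h2
  exact (ENNReal.add_right_inj (ne_top_of_le_ne_top hfin
    (measure_mono Set.inter_subset_right))).1 h2

/-- Some polarization brings `A` closer to the ball `D` by an amount that is controlled from below
by the distance of `A` from `D`. -/
theorem exists_polarize_gain (V : Type*) [NormedAddCommGroup V] [InnerProductSpace ℝ V]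
    [FiniteDimensional ℝ V] [MeasurableSpace V] [BorelSpace V] [Nontrivial V] {R : ℝ} (hR : 0 < R) :
    ∃ c : ℝ≥0∞, c ≠ 0 ∧ ∀ (A : Set V) (r : ℝ), MeasurableSet A → (∀ x ∈ A, ‖x‖ ≤ R) → r ≤ R →
      volume A = volume (Metric.ball (0 : V) r) → volume (A \ Metric.ball 0 r) ≠ 0 →
      ∃ (u : V) (t : ℝ), ‖u‖ = 1 ∧ 0 < t ∧
        volume (polarize u t A \ Metric.ball 0 r) + c * volume (A \ Metric.ball 0 r) ^ 2
          ≤ volume (A \ Metric.ball 0 r) := by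
  obtain ⟨c, hc, H⟩ := exists_reflection_overlap V hR
  refine ⟨c, hc, fun A r hA hAR hr hvol hne => ?_⟩
  set D : Set V := Metric.ball 0 r with hD
  have hDm : MeasurableSet D := measurableSet_ball
  obtain ⟨u, t, hu, hut⟩ := H (A \ D) (D \ A) (hA.diff hDm) (hDm.diff hA)
    (fun x hx => hAR x hx.1) (fun x hx => by
      have : ‖x‖ < r := by simpa [hD] using hx.1
      linarith)
  rw [volume_diff_eq_of_volume_eq hA hDm hvol measure_ball_lt_top.ne, ← sq] at hut
  -- the overlap is nonempty, so that the hyperplane does not contain `0`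
  have ht : t ≠ 0 := by
    rintro rfl
    have hpos : volume ((A \ D) ∩ hyperplaneReflection u 0 ⁻¹' (D \ A)) ≠ 0 := by
      intro h0
      rw [h0, nonpos_iff_eq_zero, mul_eq_zero] at hut
      rcases hut with h | h
      · exact hc h
      · exact hne (by simpa using h)
    obtain ⟨x, hx, hx'⟩ := nonempty_of_measure_ne_zero hpos
    have e := norm_hyperplaneReflection_sq hu 0 x
    simp only [mul_zero, zero_mul, add_zero] at e
    rw [sq_eq_sq₀ (norm_nonneg _) (norm_nonneg _)] at e
    have h1 := hx.2
    have h2 := hx'.1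
    simp only [hD, mem_ball_zero_iff] at h1 h2
    exact h1 (e ▸ h2)
  rcases lt_or_gt_of_ne ht with h | h
  · have hu' : ‖-u‖ = 1 := by rwa [norm_neg]
    refine ⟨-u, -t, hu', by linarith, le_trans (add_le_add le_rfl ?_)
      (volume_polarize_diff_ball_add_le hu' (by linarith) hA r)⟩
    rwa [hyperplaneReflection_neg]
  · exact ⟨u, t, hu, h, le_trans (add_le_add le_rfl hut)
      (volume_polarize_diff_ball_add_le hu h hA r)⟩

/-- Finitely many polarizations bring two bounded sets simultaneously as close to balls as
desired. -/
theorem exists_interaction_le_near_ball [Nontrivial V] {g : ℝ → ℝ≥0∞} (hg : Antitone g) {R : ℝ}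
    (hR : 0 < R) {A B : Set V} (hA : MeasurableSet A) (hB : MeasurableSet B)
    (hAR : ∀ x ∈ A, ‖x‖ ≤ R) (hBR : ∀ x ∈ B, ‖x‖ ≤ R) {r s : ℝ} (hr : r ≤ R) (hs : s ≤ R)
    (hAr : volume A = volume (Metric.ball (0 : V) r))
    (hBs : volume B = volume (Metric.ball (0 : V) s)) {ε : ℝ≥0∞} (hε : ε ≠ 0) :
    ∃ A' B' : Set V, MeasurableSet A' ∧ MeasurableSet B' ∧ volume A' = volume A ∧
      volume B' = volume B ∧ interaction g A B ≤ interaction g A' B' ∧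
      volume (A' \ Metric.ball 0 r) ≤ ε ∧ volume (B' \ Metric.ball 0 s) ≤ ε := by
  obtain ⟨c, hc, H⟩ := exists_polarize_gain V hR
  by_contra! hcon
  -- the pairs with all the properties that polarization preserves
  let P : Set V × Set V → Prop := fun p => MeasurableSet p.1 ∧ MeasurableSet p.2 ∧
    volume p.1 = volume A ∧ volume p.2 = volume B ∧ interaction g A B ≤ interaction g p.1 p.2 ∧
    (∀ x ∈ p.1, ‖x‖ ≤ R) ∧ ∀ x ∈ p.2, ‖x‖ ≤ R
  let δ : Set V × Set V → ℝ≥0∞ := fun p =>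
    volume (p.1 \ Metric.ball 0 r) + volume (p.2 \ Metric.ball 0 s)
  have hpol : ∀ p, P p → ∀ (u : V) (t : ℝ), ‖u‖ = 1 → 0 < t →
      P (polarize u t p.1, polarize u t p.2) := by
    rintro ⟨A', B'⟩ ⟨h1, h2, h3, h4, h5, h6, h7⟩ u t hu ht
    exact ⟨measurableSet_polarize u t h1, measurableSet_polarize u t h2,
      (volume_polarize hu t h1).trans h3, (volume_polarize hu t h2).trans h4,
      h5.trans (interaction_le_polarize hg hu t h1 h2), norm_le_of_mem_polarize hu ht h6,
      norm_le_of_mem_polarize hu ht h7⟩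
  have hmono : ∀ (A' : Set V) (ρ : ℝ) (u : V) (t : ℝ), MeasurableSet A' → ‖u‖ = 1 → 0 < t →
      volume (polarize u t A' \ Metric.ball 0 ρ) ≤ volume (A' \ Metric.ball 0 ρ) :=
    fun A' ρ u t h hu ht => le_self_add.trans (volume_polarize_diff_ball_add_le hu ht h ρ)
  have hstep : ∀ p, P p → ∃ q, P q ∧ δ q + c * ε ^ 2 ≤ δ p := by
    rintro ⟨A', B'⟩ hp
    have hp' := hp
    obtain ⟨h1, h2, h3, h4, h5, h6, h7⟩ := hp'
    by_cases hA' : volume (A' \ Metric.ball 0 r) ≤ ε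
    · have hlt := hcon A' B' h1 h2 h3 h4 h5 hA'
      obtain ⟨u, t, hu, ht, hut⟩ := H B' s h2 h7 hs (h4.trans hBs) hlt.ne_bot
      refine ⟨_, hpol _ hp u t hu ht, ?_⟩
      change volume _ + volume _ + _ ≤ volume _ + volume _
      rw [add_assoc]
      refine add_le_add (hmono A' r u t h1 hu ht) (le_trans ?_ hut)
      gcongr
    · rw [not_le] at hA'
      obtain ⟨u, t, hu, ht, hut⟩ := H A' r h1 h6 hr (h3.trans hAr) hA'.ne_bot
      refine ⟨_, hpol _ hp u t hu ht, ?_⟩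
      change volume _ + volume _ + _ ≤ volume _ + volume _
      rw [add_right_comm]
      refine add_le_add (le_trans ?_ hut) (hmono B' s u t h2 hu ht)
      gcongr
  have hP : P (A, B) := ⟨hA, hB, rfl, rfl, le_rfl, hAR, hBR⟩
  -- the infimum of `δ` over all such pairs could be undercut
  set m : ℝ≥0∞ := ⨅ p : {p // P p}, δ p.1 with hm
  have hmle : ∀ p, P p → m ≤ δ p := fun p hp => iInf_le (fun p : {p // P p} => δ p.1) ⟨p, hp⟩
  have hmfin : m ≠ ∞ := by
    refine ne_top_of_le_ne_top (ENNReal.add_ne_top.2 ⟨?_, ?_⟩) (hmle _ hP)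
    · exact ne_top_of_le_ne_top (hAr ▸ measure_ball_lt_top.ne) (measure_mono Set.sdiff_subset)
    · exact ne_top_of_le_ne_top (hBs ▸ measure_ball_lt_top.ne) (measure_mono Set.sdiff_subset)
  have hge : m + c * ε ^ 2 ≤ m := by
    refine le_iInf fun p => ?_
    obtain ⟨q, hq, hqp⟩ := hstep p.1 p.2
    exact (add_le_add (hmle q hq) le_rfl).trans hqp
  exact absurd hge (not_le.2 (ENNReal.lt_add_right hmfin (mul_ne_zero hc (pow_ne_zero 2 hε))))

theorem interaction_le_mul {g : ℝ → ℝ≥0∞} {M : ℝ≥0∞} (hM : ∀ ρ, g ρ ≤ M) (A B : Set V) :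
    interaction g A B ≤ M * volume B * volume A := by
  rw [← setLIntegral_const]
  refine lintegral_mono fun x => ?_
  rw [← setLIntegral_const]
  exact lintegral_mono fun y => hM _

theorem interaction_le_ball_of_bounded [Nontrivial V] {g : ℝ → ℝ≥0∞} (hg : Antitone g) {M : ℝ≥0∞}
    (hMt : M ≠ ∞) (hM : ∀ ρ, g ρ ≤ M) {R : ℝ} {A B : Set V} (hA : MeasurableSet A)
    (hB : MeasurableSet B) (hAR : ∀ x ∈ A, ‖x‖ ≤ R) (hBR : ∀ x ∈ B, ‖x‖ ≤ R) {r s : ℝ}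
    (hAr : volume A = volume (Metric.ball (0 : V) r))
    (hBs : volume B = volume (Metric.ball (0 : V) s)) :
    interaction g A B ≤ interaction g (Metric.ball (0 : V) r) (Metric.ball (0 : V) s) := by
  set R' : ℝ := max (max R 1) (max r s)
  have hR1 : R ≤ R' := (le_max_left _ _).trans (le_max_left _ _)
  have hR' : 0 < R' :=
    zero_lt_one.trans_le ((le_max_right R 1).trans (le_max_left _ _))
  have hD : ∀ ρ : ℝ, MeasurableSet (Metric.ball (0 : V) ρ) := fun _ => measurableSet_ball
  have hDt : ∀ ρ : ℝ, volume (Metric.ball (0 : V) ρ) ≠ ∞ := fun _ => measure_ball_lt_top.ne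
  set C : ℝ≥0∞ := M * volume B + M * volume A + 1 with hC
  have hCt : C ≠ ∞ := by
    rw [hC, hAr, hBs]
    finiteness [hDt r, hDt s]
  have hC0 : C ≠ 0 := by simp [hC]
  refine ENNReal.le_of_forall_pos_le_add fun ε hε _ => ?_
  obtain ⟨A', B', hA', hB', hvA, hvB, hle, hAε, hBε⟩ := exists_interaction_le_near_ball hg hR' hA hB
    (fun x hx => (hAR x hx).trans hR1) (fun x hx => (hBR x hx).trans hR1)
    ((le_max_left r s).trans (le_max_right _ _)) ((le_max_right r s).trans (le_max_right _ _))
    hAr hBs (ε := ε / C) (ENNReal.div_ne_zero.2 ⟨by exact_mod_cast hε.ne', hCt⟩)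
  have e1 : interaction g A' B' ≤ interaction g (Metric.ball (0 : V) r) B'
      + interaction g (A' \ Metric.ball (0 : V) r) B' := by
    rw [← Set.inter_union_sdiff A' (Metric.ball (0 : V) r),
      interaction_union_left g _ (hA'.diff (hD r)) Set.disjoint_sdiff_inter.symm]
    refine add_le_add (interaction_mono Set.inter_subset_right subset_rfl)
      (interaction_mono ?_ subset_rfl)
    rw [Set.inter_union_sdiff]
  have e2 : interaction g (Metric.ball (0 : V) r) B'
      ≤ interaction g (Metric.ball (0 : V) r) (Metric.ball (0 : V) s)
      + interaction g (Metric.ball (0 : V) r) (B' \ Metric.ball (0 : V) s) := by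
    rw [← Set.inter_union_sdiff B' (Metric.ball (0 : V) s),
      interaction_union_right hg _ (hB'.diff (hD s)) Set.disjoint_sdiff_inter.symm]
    refine add_le_add (interaction_mono subset_rfl Set.inter_subset_right)
      (interaction_mono subset_rfl ?_)
    rw [Set.inter_union_sdiff]
  calc interaction g A B ≤ interaction g A' B' := hle
    _ ≤ interaction g (Metric.ball (0 : V) r) (Metric.ball (0 : V) s)
        + interaction g (Metric.ball (0 : V) r) (B' \ Metric.ball (0 : V) s)
        + interaction g (A' \ Metric.ball (0 : V) r) B' := e1.trans (add_le_add e2 le_rfl)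
    _ ≤ interaction g (Metric.ball (0 : V) r) (Metric.ball (0 : V) s)
        + M * (ε / C) * volume A + M * volume B * (ε / C) := by
      gcongr
      · refine (interaction_le_mul hM _ _).trans ?_
        rw [hAr]
        gcongr
      · refine (interaction_le_mul hM _ _).trans ?_
        rw [hvB]
        gcongr
    _ = interaction g (Metric.ball (0 : V) r) (Metric.ball (0 : V) s)
        + (M * volume B + M * volume A) * (ε / C) := by ring
    _ ≤ interaction g (Metric.ball (0 : V) r) (Metric.ball (0 : V) s) + C * (ε / C) := by
      gcongr
      exact le_self_add
    _ ≤ _ := by gcongr; exact ENNReal.mul_div_le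

theorem volume_ball_lt_volume_ball [Nontrivial V] {r s : ℝ} (hr : 0 ≤ r) (hrs : r < s) :
    volume (Metric.ball (0 : V) r) < volume (Metric.ball (0 : V) s) := by
  rw [Measure.addHaar_ball _ _ hr, Measure.addHaar_ball _ _ (hr.trans hrs.le)]
  refine ENNReal.mul_lt_mul_left (Metric.measure_ball_pos volume _ one_pos).ne'
    measure_ball_lt_top.ne ?_
  exact (ENNReal.ofReal_lt_ofReal_iff (pow_pos (hr.trans_lt hrs) _)).2
    (pow_lt_pow_left₀ hrs hr Module.finrank_pos.ne')

theorem exists_volume_ball_eq [Nontrivial V] {a : ℝ≥0∞} (ha : a ≠ ∞) :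
    ∃ r : ℝ, 0 ≤ r ∧ volume (Metric.ball (0 : V) r) = a := by
  have hpos : volume (Metric.ball (0 : V) 1) ≠ 0 :=
    (Metric.measure_ball_pos volume _ one_pos).ne'
  have hfin : volume (Metric.ball (0 : V) 1) ≠ ∞ := measure_ball_lt_top.ne
  refine ⟨(a / volume (Metric.ball (0 : V) 1)).toReal ^ ((Module.finrank ℝ V : ℝ)⁻¹),
    by positivity, ?_⟩
  rw [Measure.addHaar_ball _ _ (by positivity),
    Real.rpow_inv_natCast_pow ENNReal.toReal_nonneg Module.finrank_pos.ne',
    ENNReal.ofReal_toReal (ENNReal.div_ne_top ha hpos), ENNReal.div_mul_cancel hpos hfin]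

theorem interaction_eq_iSup_inter_closedBall (g : ℝ → ℝ≥0∞) (A B : Set V) :
    interaction g A B = ⨆ n : ℕ, interaction g (A ∩ Metric.closedBall 0 n) B := by
  unfold interaction
  rw [← setLIntegral_iUnion_of_directed, ← Set.inter_iUnion, Metric.iUnion_closedBall_nat,
    Set.inter_univ]
  refine Monotone.directed_le fun m n hmn => Set.inter_subset_inter_right _ ?_
  exact Metric.closedBall_subset_closedBall (by exact_mod_cast hmn)

theorem interaction_eq_iSup_min {g : ℝ → ℝ≥0∞} (hg : Antitone g) (A B : Set V) :
    interaction g A B = ⨆ n : ℕ, interaction (fun ρ => min (g ρ) n) A B := by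
  have hgn : ∀ n : ℕ, Antitone fun ρ => min (g ρ) (n : ℝ≥0∞) := fun n =>
    hg.min antitone_const
  have hsup : ∀ a : ℝ≥0∞, a = ⨆ n : ℕ, min a n := by
    intro a
    rw [← inf_iSup_eq, ENNReal.iSup_natCast, inf_top_eq]
  have h1 : ∀ x : V, ∫⁻ y in B, g ‖x - y‖ = ⨆ n : ℕ, ∫⁻ y in B, min (g ‖x - y‖) n := by
    intro x
    rw [← lintegral_iSup]
    · exact lintegral_congr fun y => hsup _
    · exact fun n => (measurable_profile_norm_sub (hgn n)).comp measurable_prodMk_left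
    · exact fun m n hmn y => min_le_min le_rfl (by exact_mod_cast hmn)
  unfold interaction
  simp_rw [h1]
  rw [lintegral_iSup]
  · exact fun n => measurable_setLIntegral_profile (hgn n) B
  · exact fun m n hmn x => lintegral_mono fun y => min_le_min le_rfl (by exact_mod_cast hmn)

/-- Riesz's rearrangement inequality for a radially decreasing kernel. -/
theorem interaction_le_ball [Nontrivial V] {g : ℝ → ℝ≥0∞} (hg : Antitone g) {A B : Set V}
    (hA : MeasurableSet A) (hB : MeasurableSet B) {r s : ℝ} (hr : 0 ≤ r) (hs : 0 ≤ s)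
    (hAr : volume A = volume (Metric.ball (0 : V) r))
    (hBs : volume B = volume (Metric.ball (0 : V) s)) :
    interaction g A B ≤ interaction g (Metric.ball (0 : V) r) (Metric.ball (0 : V) s) := by
  have hrad : ∀ (Z : Set V) (ρ : ℝ) (n : ℕ), 0 ≤ ρ → volume Z = volume (Metric.ball (0 : V) ρ) →
      ∃ ρ' ≤ ρ, volume (Z ∩ Metric.closedBall 0 n) = volume (Metric.ball (0 : V) ρ') := by
    intro Z ρ n hρ hZ
    have hle : volume (Z ∩ Metric.closedBall 0 n) ≤ volume (Metric.ball (0 : V) ρ) :=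
      hZ ▸ measure_mono Set.inter_subset_left
    obtain ⟨ρ', -, h⟩ := exists_volume_ball_eq (V := V)
      (ne_top_of_le_ne_top measure_ball_lt_top.ne hle)
    refine ⟨ρ', ?_, h.symm⟩
    by_contra! hlt
    exact absurd (volume_ball_lt_volume_ball (V := V) hρ hlt) (not_lt.2 (h ▸ hle))
  have hcl : ∀ n : ℕ, MeasurableSet (Metric.closedBall (0 : V) n) := fun n =>
    measurableSet_closedBall
  rw [interaction_eq_iSup_inter_closedBall]
  refine iSup_le fun m => ?_
  rw [interaction_comm hg, interaction_eq_iSup_inter_closedBall]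
  refine iSup_le fun n => ?_
  rw [interaction_comm hg, interaction_eq_iSup_min hg]
  refine iSup_le fun k => ?_
  obtain ⟨r', hr', hvr⟩ := hrad A r m hr hAr
  obtain ⟨s', hs', hvs⟩ := hrad B s n hs hBs
  have hmn : ∀ x ∈ A ∩ Metric.closedBall (0 : V) m, ‖x‖ ≤ max (m : ℝ) n := fun x hx =>
    (mem_closedBall_zero_iff.1 hx.2).trans (le_max_left _ _)
  have hmn' : ∀ x ∈ B ∩ Metric.closedBall (0 : V) n, ‖x‖ ≤ max (m : ℝ) n := fun x hx =>
    (mem_closedBall_zero_iff.1 hx.2).trans (le_max_right _ _)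
  calc _ ≤ interaction (fun ρ => min (g ρ) k) (Metric.ball (0 : V) r') (Metric.ball (0 : V) s') :=
        interaction_le_ball_of_bounded (hg.min antitone_const) (ENNReal.natCast_ne_top k)
          (fun _ => min_le_right _ _) (hA.inter (hcl m)) (hB.inter (hcl n)) hmn hmn' hvr hvs
    _ ≤ interaction g (Metric.ball (0 : V) r') (Metric.ball (0 : V) s') :=
        lintegral_mono fun x => lintegral_mono fun y => min_le_left _ _
    _ ≤ _ := interaction_mono (Metric.ball_subset_ball hr') (Metric.ball_subset_ball hs')

end Riesz

/-! ### Sets that are translation invariant, or symmetric about hyperplanes -/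

section Symmetry

open Filter Topology

variable {V : Type*} [NormedAddCommGroup V] [InnerProductSpace ℝ V]
  [FiniteDimensional ℝ V] [MeasurableSpace V] [BorelSpace V]

theorem tendsto_volume_inter_le_inner {A : Set V} (hA : MeasurableSet A) (hAfin : volume A ≠ ∞)
    (v : V) : Tendsto (fun s : ℝ => volume (A ∩ {x | s ≤ inner ℝ v x})) atTop (𝓝 0) := by
  have hm : ∀ s : ℝ, MeasurableSet {x : V | s ≤ inner ℝ v x} := fun s =>
    (isClosed_le continuous_const (by fun_prop)).measurableSet
  have h := tendsto_measure_iInter_atTop (μ := volume) (s := fun s : ℝ => A ∩ {x | s ≤ inner ℝ v x})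
    (fun s => (hA.inter (hm s)).nullMeasurableSet)
    (fun s s' hs x hx => ⟨hx.1, hs.trans hx.2⟩)
    ⟨0, ne_top_of_le_ne_top hAfin (measure_mono Set.inter_subset_left)⟩
  have he : (⋂ s : ℝ, A ∩ {x | s ≤ inner ℝ v x}) = ∅ := by
    refine Set.eq_empty_of_forall_notMem fun x hx => ?_
    have := (Set.mem_iInter.1 hx (inner ℝ v x + 1)).2
    simp only [Set.mem_ofPred_eq] at this
    linarith
  rwa [he, measure_empty] at h

/-- A set of finite measure that is invariant under a translation is null. -/
theorem volume_eq_zero_of_translation_invariant {A : Set V} (hA : MeasurableSet A)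
    (hAfin : volume A ≠ ∞) {v : V} (hv : v ≠ 0) (h : (fun x => x + v) ⁻¹' A =ᵐ[volume] A) :
    volume A = 0 := by
  have hstep : ∀ s : ℝ, volume (A ∩ {x | s ≤ inner ℝ v x})
      = volume (A ∩ {x | s + ‖v‖ ^ 2 ≤ inner ℝ v x}) := by
    intro s
    have hpre : (fun x => x + v) ⁻¹' (A ∩ {x | s + ‖v‖ ^ 2 ≤ inner ℝ v x})
        = (fun x => x + v) ⁻¹' A ∩ {x | s ≤ inner ℝ v x} := by
      ext x
      simp [inner_add_right]
    rw [← measure_preimage_add_right volume v (A ∩ {x | s + ‖v‖ ^ 2 ≤ inner ℝ v x}), hpre]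
    exact measure_congr (h.symm.inter (ae_eq_refl _))
  have hk : ∀ (s : ℝ) (k : ℕ), volume (A ∩ {x | s ≤ inner ℝ v x})
      = volume (A ∩ {x | s + k * ‖v‖ ^ 2 ≤ inner ℝ v x}) := by
    intro s k
    induction k with
    | zero => simp
    | succ k ih =>
      have e : s + (k + 1 : ℕ) * ‖v‖ ^ 2 = s + k * ‖v‖ ^ 2 + ‖v‖ ^ 2 := by
        push_cast
        ring
      rw [ih, hstep, e]
  have hv2 : 0 < ‖v‖ ^ 2 := by positivity
  have hzero : ∀ s : ℝ, volume (A ∩ {x | s ≤ inner ℝ v x}) = 0 := by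
    intro s
    have ht : Tendsto (fun k : ℕ => s + k * ‖v‖ ^ 2) atTop atTop :=
      tendsto_atTop_add_const_left _ _ (tendsto_natCast_atTop_atTop.atTop_mul_const hv2)
    have h1 := (tendsto_volume_inter_le_inner hA hAfin v).comp ht
    refine tendsto_nhds_unique (tendsto_const_nhds.congr fun k => ?_) h1
    exact hk s k
  have hU : A = ⋃ n : ℕ, A ∩ {x | -(n : ℝ) ≤ inner ℝ v x} := by
    refine Set.Subset.antisymm (fun x hx => ?_) (Set.iUnion_subset fun n => Set.inter_subset_left)
    obtain ⟨n, hn⟩ := exists_nat_ge (-inner ℝ v x)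
    exact Set.mem_iUnion.2 ⟨n, hx, by simp only [Set.mem_ofPred_eq]; linarith⟩
  rw [hU]
  exact measure_iUnion_null fun n => hzero _

theorem eq_of_symmetric_of_symmetric {A : Set V} (hA : MeasurableSet A) (hAfin : volume A ≠ ∞)
    (hA0 : volume A ≠ 0) {u : V} (hu : ‖u‖ = 1) {t t' : ℝ}
    (h : hyperplaneReflection u t ⁻¹' A =ᵐ[volume] A)
    (h' : hyperplaneReflection u t' ⁻¹' A =ᵐ[volume] A) : t = t' := by
  by_contra hne
  refine hA0 (volume_eq_zero_of_translation_invariant hA hAfin (v := (2 * (t - t')) • u) ?_ ?_)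
  · have hu0 : u ≠ 0 := by rintro rfl; simp at hu
    exact smul_ne_zero (mul_ne_zero two_ne_zero (sub_ne_zero.2 hne)) hu0
  · have e : (fun x => x + (2 * (t - t')) • u)
        = hyperplaneReflection u t ∘ hyperplaneReflection u t' := by
      funext x
      rw [Function.comp, hyperplaneReflection, inner_hyperplaneReflection hu, hyperplaneReflection,
        add_assoc, ← add_smul]
      congr 2
      ring
    rw [e, Set.preimage_comp]
    exact ((measurePreserving_hyperplaneReflection hu t').quasiMeasurePreserving.preimage_ae_eq
      h).trans h'

theorem eq_of_centrally_symmetric {A : Set V} (hA : MeasurableSet A) (hAfin : volume A ≠ ∞)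
    (hA0 : volume A ≠ 0) {c c' : V} (h : (fun x => (2 : ℝ) • c - x) ⁻¹' A =ᵐ[volume] A)
    (h' : (fun x => (2 : ℝ) • c' - x) ⁻¹' A =ᵐ[volume] A) : c = c' := by
  by_contra hne
  refine hA0 (volume_eq_zero_of_translation_invariant hA hAfin (v := (2 : ℝ) • (c - c')) ?_ ?_)
  · exact smul_ne_zero two_ne_zero (sub_ne_zero.2 hne)
  · have e : (fun x => x + (2 : ℝ) • (c - c'))
        = (fun x => (2 : ℝ) • c - x) ∘ (fun x => (2 : ℝ) • c' - x) := by
      funext x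
      simp only [Function.comp, smul_sub]
      abel
    rw [e, Set.preimage_comp]
    exact ((Measure.measurePreserving_sub_left volume
      ((2 : ℝ) • c')).quasiMeasurePreserving.preimage_ae_eq
      h).trans h'

/-- A set without unpaired points is symmetric. -/
theorem symmetric_of_volume_unpaired {A : Set V} {u : V} (hu : ‖u‖ = 1) {t : ℝ}
    (h : volume (unpaired u t A) = 0) (h' : volume (unpaired (-u) (-t) A) = 0) :
    hyperplaneReflection u t ⁻¹' A =ᵐ[volume] A := by
  have h1 : A ≤ᵐ[volume] hyperplaneReflection u t ⁻¹' A := by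
    rw [ae_le_set]
    refine measure_mono_null ?_ (measure_union_null h h')
    intro x hx
    have := paired_union_unpaired u t A ▸ hx.1
    rcases this with (h | h) | h
    · exact absurd h.2 hx.2
    · exact Or.inl h
    · exact Or.inr h
  have h2 : hyperplaneReflection u t ⁻¹' A ≤ᵐ[volume] A := by
    have := (measurePreserving_hyperplaneReflection hu t).quasiMeasurePreserving.preimage_mono_ae h1
    rwa [← Set.preimage_comp, (hyperplaneReflection_involutive hu t).comp_self,
      Set.preimage_id] at this
  exact h2.antisymm h1

theorem isOpen_volume_unpaired_ne_zero {A : Set V} (hA : MeasurableSet A) (hAfin : volume A ≠ ∞)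
    {u : V} (hu : ‖u‖ = 1) : IsOpen {t : ℝ | volume (unpaired u t A) ≠ 0} := by
  rw [isOpen_iff_mem_nhds]
  intro t₀ ht₀
  -- some unpaired points have a definite distance from the hyperplane
  obtain ⟨s, hs, hX⟩ : ∃ s < t₀, volume (unpaired u t₀ A ∩ {x | inner ℝ u x < s}) ≠ 0 := by
    by_contra! hcon
    refine ht₀ ?_
    have hU : unpaired u t₀ A
        ⊆ ⋃ n : ℕ, unpaired u t₀ A ∩ {x | inner ℝ u x < t₀ - 1 / ((n : ℝ) + 1)} := by
      intro x hx
      obtain ⟨n, hn⟩ := exists_nat_one_div_lt (sub_pos.2 hx.2.1)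
      exact Set.mem_iUnion.2 ⟨n, hx, by simp only [Set.mem_ofPred_eq]; linarith⟩
    refine measure_mono_null hU (measure_iUnion_null fun n => hcon _ ?_)
    have : (0 : ℝ) < 1 / ((n : ℝ) + 1) := by positivity
    linarith
  let F : C(ℝ, C(V, V)) := ContinuousMap.curry ⟨_, continuous_hyperplaneReflection u⟩
  have hlim : Tendsto (fun t : ℝ => volume
      (symmDiff (hyperplaneReflection u t ⁻¹' A) (hyperplaneReflection u t₀ ⁻¹' A)))
      (𝓝 t₀) (𝓝 0) :=
    tendsto_measure_symmDiff_preimage_nhds_zero (f := F) (g := F t₀) (F.continuous.tendsto t₀)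
      (Eventually.of_forall fun t => measurePreserving_hyperplaneReflection hu t)
      (measurePreserving_hyperplaneReflection hu t₀) hA.nullMeasurableSet hAfin
  filter_upwards [hlim.eventually_lt_const (pos_iff_ne_zero.2 hX), lt_mem_nhds hs] with t ht hst
  intro h0
  refine absurd ht (not_lt.2 ?_)
  calc volume (unpaired u t₀ A ∩ {x | inner ℝ u x < s})
      ≤ volume (unpaired u t A ∪
          symmDiff (hyperplaneReflection u t ⁻¹' A) (hyperplaneReflection u t₀ ⁻¹' A)) := by
        refine measure_mono ?_
        rintro x ⟨⟨h1, h2, h3⟩, h4⟩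
        by_cases h5 : hyperplaneReflection u t x ∈ A
        · exact Or.inr (Or.inl ⟨h5, h3⟩)
        · exact Or.inl ⟨h1, lt_trans h4 hst, h5⟩
    _ ≤ _ := (measure_union_le _ _).trans (by rw [h0, zero_add])

theorem isOpen_volume_unpaired_neg_ne_zero {A : Set V} (hA : MeasurableSet A)
    (hAfin : volume A ≠ ∞) {u : V} (hu : ‖u‖ = 1) :
    IsOpen {t : ℝ | volume (unpaired (-u) (-t) A) ≠ 0} :=
  (isOpen_volume_unpaired_ne_zero hA hAfin (u := -u) (by rwa [norm_neg])).preimage continuous_neg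

theorem eventually_volume_unpaired_ne_zero {A : Set V} (hA : MeasurableSet A)
    (hAfin : volume A ≠ ∞) (hA0 : volume A ≠ 0) {u : V} (hu : ‖u‖ = 1) :
    ∀ᶠ t : ℝ in atTop, volume (unpaired u t A) ≠ 0 := by
  have h2 : (0 : ℝ≥0∞) < volume A / 2 := ENNReal.half_pos hA0
  filter_upwards [(tendsto_volume_inter_le_inner hA hAfin u).eventually_lt_const h2] with t ht h0
  have hm : MeasurableSet {x : V | t ≤ inner ℝ u x} :=
    (isClosed_le continuous_const (by fun_prop)).measurableSet
  have h3 : A \ {x | t ≤ inner ℝ u x} ⊆ unpaired u t A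
      ∪ hyperplaneReflection u t ⁻¹' (A ∩ {x | t ≤ inner ℝ u x}) := by
    rintro x ⟨hx, hx'⟩
    simp only [Set.mem_ofPred_eq, not_le] at hx'
    by_cases h : hyperplaneReflection u t x ∈ A
    · refine Or.inr ⟨h, ?_⟩
      simp only [Set.mem_ofPred_eq, inner_hyperplaneReflection hu]
      linarith
    · exact Or.inl ⟨hx, hx', h⟩
  have h4 : volume (A \ {x | t ≤ inner ℝ u x}) ≤ volume (A ∩ {x | t ≤ inner ℝ u x}) := by
    refine (measure_mono h3).trans ((measure_union_le _ _).trans ?_)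
    rw [h0, zero_add, volume_preimage_hyperplaneReflection hu]
  have h5 := measure_inter_add_sdiff (μ := volume) A hm
  have h6 : volume A < volume A / 2 + volume A / 2 := by
    conv_lhs => rw [← h5]
    exact ENNReal.add_lt_add ht (h4.trans_lt ht)
  rw [ENNReal.add_halves] at h6
  exact lt_irrefl _ h6

end Symmetry

/-! ### Pairs of sets that are polarized in the same direction -/

section Aligned

open Filter Topology

variable {V : Type*} [NormedAddCommGroup V] [InnerProductSpace ℝ V]
  [MeasurableSpace V] [BorelSpace V] [FiniteDimensional ℝ V]

/-- For no hyperplane do `A` and `B` have non-negligible sets of unpaired points on opposite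
sides. -/
def PolarizationAligned (A B : Set V) : Prop :=
  ∀ (u : V) (t : ℝ), ‖u‖ = 1 →
    volume (unpaired u t A) = 0 ∨ volume (unpaired (-u) (-t) B) = 0

variable {A B : Set V}

/-- `A` has unpaired points on one side of a hyperplane only. Otherwise `A` would have
unpaired points on both sides of all nearby parallel hyperplanes as well, and `B` would be symmetric
about all of them. -/
theorem PolarizationAligned.volume_unpaired_eq_zero_or (h : PolarizationAligned A B)
    (hA : MeasurableSet A) (hB : MeasurableSet B) (hAfin : volume A ≠ ∞) (hBfin : volume B ≠ ∞)
    (hB0 : volume B ≠ 0) {u : V} (hu : ‖u‖ = 1) (t : ℝ) :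
    volume (unpaired u t A) = 0 ∨ volume (unpaired (-u) (-t) A) = 0 := by
  by_contra! hcon
  have hsym : ∀ s : ℝ, volume (unpaired u s A) ≠ 0 → volume (unpaired (-u) (-s) A) ≠ 0 →
      hyperplaneReflection u s ⁻¹' B =ᵐ[volume] B := by
    intro s h1 h2
    have h3 := (h (-u) (-s) (by rwa [norm_neg])).resolve_left h2
    rw [neg_neg, neg_neg] at h3
    exact symmetric_of_volume_unpaired hu h3 ((h u s hu).resolve_left h1)
  have hmem : {s : ℝ | volume (unpaired u s A) ≠ 0} ∩ {s : ℝ | volume (unpaired (-u) (-s) A) ≠ 0}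
      ∈ 𝓝 t :=
    ((isOpen_volume_unpaired_ne_zero hA hAfin hu).inter
      (isOpen_volume_unpaired_neg_ne_zero hA hAfin hu)).mem_nhds hcon
  have hev : ∀ᶠ s in 𝓝[≠] t, s = t := by
    filter_upwards [nhdsWithin_le_nhds hmem] with s hs
    exact eq_of_symmetric_of_symmetric hB hBfin hB0 hu (hsym s hs.1 hs.2) (hsym t hcon.1 hcon.2)
  obtain ⟨s, hs, hst⟩ := (hev.and self_mem_nhdsWithin).exists
  exact hst hs

theorem PolarizationAligned.volume_unpaired_of_lt (h : PolarizationAligned A B)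
    (hA : MeasurableSet A) (hB : MeasurableSet B) (hAfin : volume A ≠ ∞) (hBfin : volume B ≠ ∞)
    (hA0 : volume A ≠ 0) (hB0 : volume B ≠ 0) {u : V} (hu : ‖u‖ = 1) {t₀ t : ℝ}
    (hsym : hyperplaneReflection u t₀ ⁻¹' A =ᵐ[volume] A) (ht : t₀ < t) :
    volume (unpaired u t A) ≠ 0 ∧ volume (unpaired (-u) (-t) A) = 0
      ∧ volume (unpaired (-u) (-t) B) = 0 := by
  have hdisj := h.volume_unpaired_eq_zero_or hA hB hAfin hBfin hB0 hu
  have hcover : ∀ s, t₀ < s →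
      volume (unpaired u s A) ≠ 0 ∨ volume (unpaired (-u) (-s) A) ≠ 0 := by
    intro s hs
    by_contra! hcon
    exact hs.ne (eq_of_symmetric_of_symmetric hA hAfin hA0 hu hsym
      (symmetric_of_volume_unpaired hu hcon.1 hcon.2))
  have hN : volume (unpaired (-u) (-t) A) = 0 := by
    by_contra hN
    obtain ⟨s, hs, hs'⟩ := ((eventually_volume_unpaired_ne_zero hA hAfin hA0 hu).and
      (eventually_gt_atTop t₀)).exists
    obtain ⟨r, -, hr1, hr2⟩ := isPreconnected_Ioi (a := t₀) _ _
      (isOpen_volume_unpaired_ne_zero hA hAfin hu) (isOpen_volume_unpaired_neg_ne_zero hA hAfin hu)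
      (fun s hs => hcover s hs) ⟨s, hs', hs⟩ ⟨t, ht, hN⟩
    exact (hdisj r).elim hr1 hr2
  have hP := (hcover t ht).resolve_right (not_not.2 hN)
  exact ⟨hP, hN, (h u t hu).resolve_left hP⟩

/-- In every direction there is a unique hyperplane about which both sets are symmetric, and both
sets are polarized with respect to all the parallel hyperplanes. -/
theorem PolarizationAligned.exists_symmetric (h : PolarizationAligned A B)
    (hA : MeasurableSet A) (hB : MeasurableSet B) (hAfin : volume A ≠ ∞) (hBfin : volume B ≠ ∞)
    (hA0 : volume A ≠ 0) (hB0 : volume B ≠ 0) {u : V} (hu : ‖u‖ = 1) :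
    ∃ t₀ : ℝ, hyperplaneReflection u t₀ ⁻¹' A =ᵐ[volume] A ∧
      hyperplaneReflection u t₀ ⁻¹' B =ᵐ[volume] B ∧
      ∀ t, t₀ < t → volume (unpaired (-u) (-t) A) = 0 ∧ volume (unpaired (-u) (-t) B) = 0 := by
  have hu' : ‖-u‖ = 1 := by rwa [norm_neg]
  have hdisj := h.volume_unpaired_eq_zero_or hA hB hAfin hBfin hB0 hu
  obtain ⟨t₀, hsym⟩ : ∃ t₀ : ℝ, hyperplaneReflection u t₀ ⁻¹' A =ᵐ[volume] A := by
    by_contra! hcon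
    obtain ⟨s, hs⟩ := (eventually_volume_unpaired_ne_zero hA hAfin hA0 hu).exists
    obtain ⟨s', hs'⟩ := (eventually_volume_unpaired_ne_zero hA hAfin hA0 hu').exists
    obtain ⟨r, -, hr1, hr2⟩ := isPreconnected_univ (α := ℝ) _ _
      (isOpen_volume_unpaired_ne_zero hA hAfin hu) (isOpen_volume_unpaired_neg_ne_zero hA hAfin hu)
      (fun t _ => by
        by_contra hnot
        simp only [Set.mem_union, Set.mem_ofPred_eq, not_or, not_not] at hnot
        exact hcon t (symmetric_of_volume_unpaired hu hnot.1 hnot.2))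
      ⟨s, trivial, hs⟩ ⟨-s', trivial, by simpa using hs'⟩
    exact (hdisj r).elim hr1 hr2
  have hgt := fun t (ht : t₀ < t) =>
    h.volume_unpaired_of_lt hA hB hAfin hBfin hA0 hB0 hu hsym ht
  have hlt : ∀ t, t < t₀ → volume (unpaired u t B) = 0 := by
    intro t ht
    have := (h.volume_unpaired_of_lt hA hB hAfin hBfin hA0 hB0 hu' (t₀ := -t₀) (t := -t)
      (by rwa [hyperplaneReflection_neg]) (by linarith)).2.2
    rwa [neg_neg, neg_neg] at this
  refine ⟨t₀, hsym, symmetric_of_volume_unpaired hu ?_ ?_, fun t ht => (hgt t ht).2⟩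
  · by_contra hne
    have hmem := (isOpen_volume_unpaired_ne_zero hB hBfin hu).mem_nhds hne
    obtain ⟨s, hs, hs'⟩ := Filter.nonempty_of_mem
      (Filter.inter_mem (mem_nhdsWithin_of_mem_nhds (t := Set.Iio t₀) hmem) self_mem_nhdsWithin)
    exact hs (hlt s hs')
  · by_contra hne
    have hmem := (isOpen_volume_unpaired_neg_ne_zero hB hBfin hu).mem_nhds hne
    obtain ⟨s, hs, hs'⟩ := Filter.nonempty_of_mem
      (Filter.inter_mem (mem_nhdsWithin_of_mem_nhds (t := Set.Ioi t₀) hmem) self_mem_nhdsWithin)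
    exact hs (hgt s hs').2.2

/-- A set that is symmetric about `dim V` pairwise orthogonal hyperplanes is symmetric about their
intersection point. -/
theorem centrally_symmetric_of_orthonormalBasis {ι : Type*} [Fintype ι] [DecidableEq ι]
    (b : OrthonormalBasis ι ℝ V) (τ : ι → ℝ)
    (h : ∀ i, hyperplaneReflection (b i) (τ i) ⁻¹' A =ᵐ[volume] A) :
    (fun x => (2 : ℝ) • (∑ i, τ i • b i) - x) ⁻¹' A =ᵐ[volume] A := by
  have key : ∀ S : Finset ι,
      (fun x => x + ∑ i ∈ S, (2 * (τ i - inner ℝ (b i) x)) • b i) ⁻¹' A =ᵐ[volume] A := by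
    intro S
    induction S using Finset.induction_on with
    | empty =>
      simp only [Finset.sum_empty, add_zero]
      exact Filter.EventuallyEq.rfl
    | insert j S hj ih =>
      have e : (fun x => x + ∑ i ∈ insert j S, (2 * (τ i - inner ℝ (b i) x)) • b i)
          = (fun x => x + ∑ i ∈ S, (2 * (τ i - inner ℝ (b i) x)) • b i)
            ∘ hyperplaneReflection (b j) (τ j) := by
        funext x
        rw [Finset.sum_insert hj, ← add_assoc]
        refine congrArg₂ (· + ·) rfl (Finset.sum_congr rfl fun i hi => ?_)
        have hij : i ≠ j := fun hij => hj (hij ▸ hi)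
        rw [hyperplaneReflection, inner_add_right, inner_smul_right, b.inner_eq_zero hij]
        simp
      rw [e, Set.preimage_comp]
      exact ((measurePreserving_hyperplaneReflection (b.norm_eq_one j)
        (τ j)).quasiMeasurePreserving.preimage_ae_eq ih).trans (h j)
  have e : (fun x => (2 : ℝ) • (∑ i, τ i • b i) - x)
      = fun x => x + ∑ i, (2 * (τ i - inner ℝ (b i) x)) • b i := by
    funext x
    simp only [mul_sub, sub_smul, Finset.sum_sub_distrib, mul_smul, ← Finset.smul_sum, b.sum_repr']
    rw [two_smul ℝ x]
    abel
  rw [e]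
  exact key Finset.univ

/-- A set that is symmetric about a point and about a hyperplane is null, or the point lies on
the hyperplane. -/
theorem inner_eq_of_symmetric (hA : MeasurableSet A) (hAfin : volume A ≠ ∞)
    (hA0 : volume A ≠ 0) {c u : V} (hu : ‖u‖ = 1) {t : ℝ}
    (hc : (fun x => (2 : ℝ) • c - x) ⁻¹' A =ᵐ[volume] A)
    (ht : hyperplaneReflection u t ⁻¹' A =ᵐ[volume] A) : inner ℝ u c = t := by
  have e : (fun x => (2 : ℝ) • hyperplaneReflection u t c - x)
      = hyperplaneReflection u t ∘ (fun x => (2 : ℝ) • c - x) ∘ hyperplaneReflection u t := by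
    funext x
    simp only [Function.comp, hyperplaneReflection, inner_sub_right, inner_add_right,
      inner_smul_right, real_inner_self_eq_norm_sq, hu]
    module
  have hc' : (fun x => (2 : ℝ) • hyperplaneReflection u t c - x) ⁻¹' A =ᵐ[volume] A := by
    rw [e, Set.preimage_comp, Set.preimage_comp]
    have hσ := (measurePreserving_hyperplaneReflection hu t).quasiMeasurePreserving
    have hκ := (Measure.measurePreserving_sub_left (volume : Measure V)
      ((2 : ℝ) • c)).quasiMeasurePreserving
    exact (hσ.preimage_ae_eq (hκ.preimage_ae_eq ht)).trans ((hσ.preimage_ae_eq hc).trans ht)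
  have h := eq_of_centrally_symmetric hA hAfin hA0 hc' hc
  have hu0 : u ≠ 0 := by rintro rfl; simp at hu
  rw [hyperplaneReflection, add_eq_left, smul_eq_zero] at h
  have := h.resolve_right hu0
  linarith

theorem PolarizationAligned.exists_center (h : PolarizationAligned A B)
    (hA : MeasurableSet A) (hB : MeasurableSet B) (hAfin : volume A ≠ ∞) (hBfin : volume B ≠ ∞)
    (hA0 : volume A ≠ 0) (hB0 : volume B ≠ 0) :
    ∃ c : V, ∀ (u : V) (t : ℝ), ‖u‖ = 1 → inner ℝ u c < t →
      volume (unpaired (-u) (-t) A) = 0 ∧ volume (unpaired (-u) (-t) B) = 0 := by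
  have H := fun (u : V) (hu : ‖u‖ = 1) =>
    h.exists_symmetric hA hB hAfin hBfin hA0 hB0 hu
  choose τ hτA hτB hτ using H
  let b := stdOrthonormalBasis ℝ V
  have hc := centrally_symmetric_of_orthonormalBasis b (fun i => τ (b i) (b.norm_eq_one i))
    (fun i => hτA (b i) (b.norm_eq_one i))
  refine ⟨∑ i, τ (b i) (b.norm_eq_one i) • b i, fun u t hu ht => hτ u hu t ?_⟩
  rwa [← inner_eq_of_symmetric hA hAfin hA0 hu hc (hτA u hu)]

/-- A set that is polarized towards all half-spaces containing `c` is a ball centered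
at `c`: a density point of the set cannot be farther from `c` than a density point of the
complement, as the reflection that exchanges the two points shows. -/
theorem ae_eq_ball_of_volume_unpaired (hA : MeasurableSet A) {c : V}
    (h : ∀ (u : V) (t : ℝ), ‖u‖ = 1 → inner ℝ u c < t → volume (unpaired (-u) (-t) A) = 0) {r : ℝ}
    (hr : volume A = volume (Metric.ball c r)) : A =ᵐ[volume] Metric.ball c r := by
  have hdens := Besicovitch.ae_tendsto_measure_inter_div_of_measurableSet (volume : Measure V) hA
  set G : Set V := {x | Tendsto (fun ρ => volume (A ∩ Metric.closedBall x ρ)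
    / volume (Metric.closedBall x ρ)) (𝓝[>] 0) (𝓝 (A.indicator 1 x))} with hG
  have hGnull : volume Gᶜ = 0 := hdens
  have key : ∀ x ∈ A, x ∈ G → ∀ y, y ∉ A → y ∈ G → ‖x - c‖ ≤ ‖y - c‖ := by
    intro x hx hxG y hy hyG
    by_contra! hlt
    have hxy : x ≠ y := by rintro rfl; exact hy hx
    have hpos : 0 < ‖x - y‖ := norm_pos_iff.2 (sub_ne_zero.2 hxy)
    set u : V := ‖x - y‖⁻¹ • (x - y) with hudef
    set t : ℝ := (‖x‖ ^ 2 - ‖y‖ ^ 2) / (2 * ‖x - y‖) with htdef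
    have hu : ‖u‖ = 1 := by rw [hudef, norm_smul, norm_inv, norm_norm, inv_mul_cancel₀ hpos.ne']
    have hσ : hyperplaneReflection u t x = y := hyperplaneReflection_bisector hxy
    have hct : inner ℝ u c < t := by
      rw [← sq_lt_sq₀ (norm_nonneg _) (norm_nonneg _), norm_sub_sq_real, norm_sub_sq_real] at hlt
      rw [hudef, htdef, inner_smul_left, inner_sub_left, conj_trivial, inv_mul_eq_div,
        div_lt_div_iff₀ hpos (by positivity)]
      nlinarith
    have hxt : t < inner ℝ u x := by
      have e : inner ℝ (x - y) x = (‖x - y‖ ^ 2 + ‖x‖ ^ 2 - ‖y‖ ^ 2) / 2 := by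
        rw [norm_sub_sq_real, inner_sub_left, real_inner_self_eq_norm_sq, real_inner_comm]
        ring
      rw [hudef, htdef, inner_smul_left, e, conj_trivial, inv_mul_eq_div,
        div_lt_div_iff₀ (by positivity) hpos]
      nlinarith [sq_nonneg ‖x - y‖, mul_pos hpos (mul_pos hpos hpos)]
    have hpre : ∀ ρ : ℝ, hyperplaneReflection u t ⁻¹' Metric.closedBall y ρ
        = Metric.closedBall x ρ := by
      intro ρ
      ext z
      rw [Set.mem_preimage, mem_closedBall_iff_norm, mem_closedBall_iff_norm, ← hσ,
        dist_hyperplaneReflection hu]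
    have hev : ∀ᶠ ρ in 𝓝[>] (0 : ℝ), volume (A ∩ Metric.closedBall x ρ)
        / volume (Metric.closedBall x ρ) ≤ volume (A ∩ Metric.closedBall y ρ)
        / volume (Metric.closedBall y ρ) := by
      have hopen : IsOpen {z : V | t < inner ℝ u z} := isOpen_lt continuous_const (by fun_prop)
      obtain ⟨ε, hε, hsub⟩ := Metric.isOpen_iff.1 hopen x hxt
      filter_upwards [Ioo_mem_nhdsGT hε] with ρ hρ
      have h1 : volume (Metric.closedBall x ρ) = volume (Metric.closedBall y ρ) := by
        rw [← hpre, volume_preimage_hyperplaneReflection hu]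
      rw [h1]
      refine ENNReal.div_le_div_right ?_ _
      rw [← volume_preimage_hyperplaneReflection hu t (A ∩ Metric.closedBall y ρ)]
      refine measure_mono_ae ?_
      rw [ae_le_set]
      refine measure_mono_null ?_ (h u t hu hct)
      rintro z ⟨⟨hzA, hzx⟩, hz⟩
      refine mem_unpaired_neg.2 ⟨hzA, hsub (Metric.closedBall_subset_ball hρ.2 hzx), fun hσz => ?_⟩
      refine hz ⟨hσz, ?_⟩
      rw [← Set.mem_preimage, hpre]
      exact hzx
    have := le_of_tendsto_of_tendsto hxG hyG hev
    simp [hx, hy] at this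
  have hDm : MeasurableSet (Metric.ball c r) := measurableSet_ball
  have heq := volume_diff_eq_of_volume_eq hA hDm hr measure_ball_lt_top.ne
  have hzero : volume (A \ Metric.ball c r) = 0 := by
    by_contra hne
    have hne' : volume (Metric.ball c r \ A) ≠ 0 := heq ▸ hne
    obtain ⟨x, ⟨hxA, hxr⟩, hxG⟩ := nonempty_of_measure_ne_zero
      (ne_of_eq_of_ne (measure_sdiff_null hGnull) hne)
    obtain ⟨y, ⟨hyr, hyA⟩, hyG⟩ := nonempty_of_measure_ne_zero
      (ne_of_eq_of_ne (measure_sdiff_null hGnull) hne')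
    have := key x hxA (not_not.1 hxG) y hyA (not_not.1 hyG)
    rw [mem_ball_iff_norm] at hxr hyr
    linarith
  exact (ae_le_set.2 hzero).antisymm (ae_le_set.2 (heq.trans hzero))

/-- The equality case of Riesz's rearrangement inequality for a strictly decreasing kernel. -/
theorem exists_ae_eq_ball_of_interaction_eq [Nontrivial V] {g : ℝ → ℝ≥0∞} (hg : Antitone g)
    (hgs : StrictAntiOn g (Set.Ici 0)) (hA : MeasurableSet A) (hB : MeasurableSet B)
    (hA0 : volume A ≠ 0) (hB0 : volume B ≠ 0) {r s : ℝ} (hr : 0 ≤ r) (hs : 0 ≤ s)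
    (hAr : volume A = volume (Metric.ball (0 : V) r))
    (hBs : volume B = volume (Metric.ball (0 : V) s)) (hfin : interaction g A B ≠ ∞)
    (heq : interaction g (Metric.ball (0 : V) r) (Metric.ball (0 : V) s) ≤ interaction g A B) :
    ∃ c : V, A =ᵐ[volume] Metric.ball c r ∧ B =ᵐ[volume] Metric.ball c s := by
  have hal : PolarizationAligned A B := fun u t hu =>
    volume_unpaired_eq_zero_or hg hgs hu t hA hB hfin <|
      (interaction_le_ball hg (measurableSet_polarize u t hA) (measurableSet_polarize u t hB) hr hs
        ((volume_polarize hu t hA).trans hAr) ((volume_polarize hu t hB).trans hBs)).trans heq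
  obtain ⟨c, hc⟩ := hal.exists_center hA hB (hAr ▸ measure_ball_lt_top.ne)
    (hBs ▸ measure_ball_lt_top.ne) hA0 hB0
  refine ⟨c, ae_eq_ball_of_volume_unpaired hA (fun u t hu ht => (hc u t hu ht).1) ?_,
    ae_eq_ball_of_volume_unpaired hB (fun u t hu ht => (hc u t hu ht).2) ?_⟩
  · rw [hAr, Measure.addHaar_ball_center volume c]
  · rw [hBs, Measure.addHaar_ball_center volume c]

end Aligned

/-! ### The nonlocal interaction of two cross sections -/

section CrossSections

variable {d : ℕ} {A B : Set (EuclideanSpace ℝ (Fin d))}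

theorem schwarzRadius_nonneg (A : Set (EuclideanSpace ℝ (Fin d))) :
    0 ≤ schwarzRadius A := Real.rpow_nonneg ENNReal.toReal_nonneg _

theorem schwarz_of_volume_ne_top
    (hA : volume A ≠ ∞) : schwarz A = Metric.ball 0 (schwarzRadius A) := if_neg hA

theorem interaction_add_compl {g : ℝ → ℝ≥0∞} (hg : Antitone g) (A : Set (EuclideanSpace ℝ (Fin d)))
    (hB : MeasurableSet B) :
    interaction g A B + interaction g A Bᶜ
      = (∫⁻ x : EuclideanSpace ℝ (Fin d), g ‖x‖) * volume A := by
  rw [← interaction_union_right hg A hB.compl disjoint_compl_right, Set.union_compl_self,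
    ← setLIntegral_const]
  refine lintegral_congr fun x => ?_
  rw [Measure.restrict_univ]
  exact lintegral_sub_left_eq_self (fun y => g ‖y‖) x

/-- The center of a ball is determined by the ball up to null sets. -/
theorem eq_of_ae_eq_ball (hAfin : volume A ≠ ∞) (hA0 : volume A ≠ 0)
    {c c' : EuclideanSpace ℝ (Fin d)} {r : ℝ}
    (h : A =ᵐ[volume] Metric.ball c r) (h' : A =ᵐ[volume] Metric.ball c' r) : c = c' := by
  have hsym : ∀ c : EuclideanSpace ℝ (Fin d),
      (fun x => (2 : ℝ) • c - x) ⁻¹' Metric.ball c r = Metric.ball c r := by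
    intro c
    ext x
    rw [Set.mem_preimage, mem_ball_iff_norm, mem_ball_iff_norm, two_smul, norm_sub_rev]
    congr! 2
    abel
  have hcc := h.symm.trans h'
  refine eq_of_centrally_symmetric (A := Metric.ball c r) measurableSet_ball ?_ ?_
    (Filter.EventuallyEq.of_eq (hsym c)) ?_
  · rwa [← measure_congr h]
  · rwa [← measure_congr h]
  · have hq := ((Measure.measurePreserving_sub_left volume
      ((2 : ℝ) • c')).quasiMeasurePreserving.preimage_ae_eq hcc)
    rw [hsym c'] at hq
    exact hq.trans hcc.symm

variable [NeZero d]

theorem volume_eq_volume_ball_schwarzRadius (hA : volume A ≠ ∞) :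
    volume A = volume (Metric.ball (0 : EuclideanSpace ℝ (Fin d)) (schwarzRadius A)) := by
  rw [← schwarz_of_volume_ne_top hA, volume_schwarz (NeZero.one_le)]

/-- The Schwarz rearrangement lowers the interaction of a set with the complement of another
one. -/
theorem interaction_schwarz_compl_le {g : ℝ → ℝ≥0∞} (hg : Antitone g)
    (hgint : ∫⁻ x : EuclideanSpace ℝ (Fin d), g ‖x‖ ≠ ∞) (hA : MeasurableSet A)
    (hB : MeasurableSet B) (hAfin : volume A ≠ ∞) :
    interaction g (schwarz A) (schwarz B)ᶜ ≤ interaction g A Bᶜ := by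
  by_cases hBfin : volume B = ∞
  · rw [schwarz, schwarz, if_pos hBfin]
    simp [interaction]
  · have hle := interaction_le_ball hg hA hB (schwarzRadius_nonneg A) (schwarzRadius_nonneg B)
      (volume_eq_volume_ball_schwarzRadius hAfin) (volume_eq_volume_ball_schwarzRadius hBfin)
    rw [schwarz_of_volume_ne_top hAfin, schwarz_of_volume_ne_top hBfin]
    set A' : Set (EuclideanSpace ℝ (Fin d)) := Metric.ball 0 (schwarzRadius A) with hA'
    set B' : Set (EuclideanSpace ℝ (Fin d)) := Metric.ball 0 (schwarzRadius B) with hB'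
    have h1 := interaction_add_compl hg A hB
    have h2 := interaction_add_compl hg A' (B := B') measurableSet_ball
    rw [← volume_eq_volume_ball_schwarzRadius hAfin, ← h1] at h2
    have hfin : interaction g A B ≠ ∞ := by
      refine ne_top_of_le_ne_top (ENNReal.mul_ne_top hgint hAfin) ?_
      rw [← h1]
      exact le_self_add
    refine (ENNReal.add_le_add_iff_left hfin).1 ?_
    rw [← h2]
    gcongr

/-- The equality case of `interaction_schwarz_compl_le`. -/
theorem ae_eq_univ_or_exists_ae_eq_ball {g : ℝ → ℝ≥0∞} (hg : Antitone g)
    (hgs : StrictAntiOn g (Set.Ici 0))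
    (hgint : ∫⁻ x : EuclideanSpace ℝ (Fin d), g ‖x‖ ≠ ∞) (hA : MeasurableSet A)
    (hB : MeasurableSet B) (hAfin : volume A ≠ ∞) (hA0 : volume A ≠ 0) (hB0 : volume B ≠ 0)
    (heq : interaction g (schwarz A) (schwarz B)ᶜ = interaction g A Bᶜ) :
    (volume B = ∞ ∧ B =ᵐ[volume] Set.univ) ∨ volume B ≠ ∞ ∧
      ∃ c, A =ᵐ[volume] Metric.ball c (schwarzRadius A)
        ∧ B =ᵐ[volume] Metric.ball c (schwarzRadius B) := by
  by_cases hBfin : volume B = ∞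
  · refine Or.inl ⟨hBfin, ?_⟩
    have h0 : interaction g A Bᶜ = 0 := by
      rw [← heq, schwarz, schwarz, if_pos hBfin]
      simp [interaction]
    rw [ae_eq_univ]
    by_contra hne
    -- a strictly decreasing profile is positive
    have hpos : ∀ x y : EuclideanSpace ℝ (Fin d), g ‖x - y‖ ≠ 0 := fun x y =>
      (hgs (norm_nonneg (x - y)) (by positivity : (0 : ℝ) ≤ ‖x - y‖ + 1)
        (lt_add_one _)).ne_bot
    rw [interaction, lintegral_eq_zero_iff (measurable_setLIntegral_profile hg _)] at h0
    have hne' : (ae (volume.restrict A)).NeBot := by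
      rw [ae_neBot]
      simpa using hA0
    obtain ⟨x, hx⟩ := h0.exists
    simp only [Pi.zero_apply] at hx
    have hm : Measurable fun y => g ‖x - y‖ :=
      (measurable_profile_norm_sub hg).comp measurable_prodMk_left
    rw [lintegral_eq_zero_iff hm] at hx
    have hne'' : (ae (volume.restrict Bᶜ)).NeBot := by
      rw [ae_neBot]
      simpa using hne
    obtain ⟨y, hy⟩ := hx.exists
    exact hpos x y hy
  · refine Or.inr ⟨hBfin, ?_⟩
    have hvA := volume_eq_volume_ball_schwarzRadius hAfin
    have hvB := volume_eq_volume_ball_schwarzRadius hBfin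
    rw [schwarz_of_volume_ne_top hAfin, schwarz_of_volume_ne_top hBfin] at heq
    have h1 := interaction_add_compl hg A hB
    have h2 := interaction_add_compl hg
      (Metric.ball (0 : EuclideanSpace ℝ (Fin d)) (schwarzRadius A))
      (B := Metric.ball 0 (schwarzRadius B)) measurableSet_ball
    rw [← hvA, ← h1, heq] at h2
    have hsum : interaction g A B + interaction g A Bᶜ ≠ ∞ := by
      rw [h1]
      exact ENNReal.mul_ne_top hgint hAfin
    rw [ENNReal.add_ne_top] at hsum
    exact exists_ae_eq_ball_of_interaction_eq hg hgs hA hB hA0 hB0 (schwarzRadius_nonneg A)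
      (schwarzRadius_nonneg B) hvA hvB hsum.1 ((ENNReal.add_left_inj hsum.2).1 h2).le

end CrossSections

/-! ### The radial profiles of the kernel -/

section Profile

variable {n : ℕ} {K : CylSpace n → ℝ}

/-- The profile of `K (z, ·)` along the ray spanned by a unit vector `e`. Its value at `0` is
irrelevant for integrals, and `∞` makes the profile strictly decreasing on `[0, ∞)`. -/
noncomputable def radialProfile (K : CylSpace n → ℝ) (e : Transversal n) (z ρ : ℝ) : ℝ≥0∞ :=
  if ρ ≤ 0 then ∞ else ENNReal.ofReal (K (z, ρ • e))

theorem radialProfile_lt (hKpos : ∀ x, 0 < K x) (hKdec : RadiallyDecreasing K)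
    {e : Transversal n} (he : ‖e‖ = 1) (z : ℝ) {ρ σ : ℝ} (hσ : 0 < σ) (h : ρ < σ) :
    radialProfile K e z σ < radialProfile K e z ρ := by
  unfold radialProfile
  rw [if_neg hσ.not_ge]
  split_ifs with hρ
  · exact ENNReal.ofReal_lt_top
  · rw [not_le] at hρ
    rw [ENNReal.ofReal_lt_ofReal_iff (hKpos _)]
    refine hKdec z _ _ ?_ ?_ <;>
      simp only [norm_smul, he, Real.norm_eq_abs, abs_of_pos hρ, abs_of_pos hσ, mul_one] <;>
      assumption

theorem antitone_radialProfile (hKpos : ∀ x, 0 < K x) (hKdec : RadiallyDecreasing K)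
    {e : Transversal n} (he : ‖e‖ = 1) (z : ℝ) : Antitone (radialProfile K e z) := by
  intro ρ σ h
  rcases h.eq_or_lt with rfl | h
  · exact le_rfl
  rcases le_or_gt σ 0 with hσ | hσ
  · simp [radialProfile, hσ, h.le.trans hσ]
  · exact (radialProfile_lt hKpos hKdec he z hσ h).le

theorem strictAntiOn_radialProfile (hKpos : ∀ x, 0 < K x) (hKdec : RadiallyDecreasing K)
    {e : Transversal n} (he : ‖e‖ = 1) (z : ℝ) :
    StrictAntiOn (radialProfile K e z) (Set.Ici 0) := fun _ hρ _ _ h =>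
  radialProfile_lt hKpos hKdec he z (lt_of_le_of_lt hρ h) h

theorem radialProfile_norm (hKrot : RotInvariant K) {e : Transversal n} (he : ‖e‖ = 1) (z : ℝ)
    {x : Transversal n} (hx : x ≠ 0) :
    radialProfile K e z ‖x‖ = ENNReal.ofReal (K (z, x)) := by
  rw [radialProfile, if_neg (norm_pos_iff.2 hx).not_ge]
  have h : ‖‖x‖ • e‖ = ‖x‖ := by rw [norm_smul, he, norm_norm, mul_one]
  have h' := hKrot (Submodule.reflection (ℝ ∙ (‖x‖ • e - x))ᗮ) z (‖x‖ • e)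
  rw [Submodule.reflection_sub h] at h'
  rw [h']

end Profile

/-! ### The perimeter as an integral over pairs of cross sections -/

section Slicing

variable {n : ℕ}

instance : (volume : Measure (CylSpace n)).IsAddHaarMeasure :=
  Measure.prod.instIsAddHaarMeasure (volume : Measure ℝ) (volume : Measure (Transversal n))

theorem measurableSet_transversalSection {E : Set (CylSpace n)} (hE : MeasurableSet E) (x₁ : ℝ) :
    MeasurableSet (transversalSection E x₁) := measurable_prodMk_left hE

theorem setLIntegral_eq_lintegral_transversalSection {S : Set (CylSpace n)} (hS : MeasurableSet S)
    {f : CylSpace n → ℝ≥0∞} (hf : Measurable f) :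
    ∫⁻ x in S, f x = ∫⁻ x₁, ∫⁻ x' in transversalSection S x₁, f (x₁, x') := by
  rw [← lintegral_indicator hS, Measure.volume_eq_prod,
    lintegral_prod _ (hf.indicator hS).aemeasurable]
  refine lintegral_congr fun x₁ => ?_
  rw [← lintegral_indicator (measurableSet_transversalSection hS x₁)]
  rfl

/-- The contribution of the cross sections at `x₁` and `y₁` to the perimeter of `E`. -/
noncomputable def sectionInteraction (κ : CylSpace n → ℝ≥0∞) (E : Set (CylSpace n)) (x₁ y₁ : ℝ) :
    ℝ≥0∞ :=
  ∫⁻ x' in transversalSection E x₁, ∫⁻ y' in (transversalSection E y₁)ᶜ, κ (x₁ - y₁, x' - y')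

theorem measurable_setLIntegral_compl_transversalSection {κ : CylSpace n → ℝ≥0∞}
    (hκ : Measurable κ) {E : Set (CylSpace n)} (hE : MeasurableSet E) :
    Measurable fun p : (ℝ × ℝ) × Transversal n =>
      ∫⁻ y' in (transversalSection E p.1.2)ᶜ, κ (p.1.1 - p.1.2, p.2 - y') := by
  have h : ∀ p : (ℝ × ℝ) × Transversal n,
      ∫⁻ y' in (transversalSection E p.1.2)ᶜ, κ (p.1.1 - p.1.2, p.2 - y')
        = ∫⁻ y', Set.indicator {q : ((ℝ × ℝ) × Transversal n) × Transversal n |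
            (q.1.1.2, q.2) ∈ Eᶜ} (fun q => κ (q.1.1.1 - q.1.1.2, q.1.2 - q.2)) (p, y') := by
    intro p
    rw [← lintegral_indicator (measurableSet_transversalSection hE p.1.2).compl]
    rfl
  simp_rw [h]
  refine Measurable.lintegral_prod_right' (Measurable.indicator (hκ.comp (by fun_prop)) ?_)
  have hm : Measurable fun q : ((ℝ × ℝ) × Transversal n) × Transversal n => (q.1.1.2, q.2) := by
    fun_prop
  exact hm hE.compl

theorem measurable_sectionInteraction {κ : CylSpace n → ℝ≥0∞} (hκ : Measurable κ)
    {E : Set (CylSpace n)} (hE : MeasurableSet E) :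
    Measurable fun p : ℝ × ℝ => sectionInteraction κ E p.1 p.2 := by
  have h : ∀ p : ℝ × ℝ, sectionInteraction κ E p.1 p.2
      = ∫⁻ x', Set.indicator {q : (ℝ × ℝ) × Transversal n | (q.1.1, q.2) ∈ E}
        (fun q => ∫⁻ y' in (transversalSection E q.1.2)ᶜ, κ (q.1.1 - q.1.2, q.2 - y')) (p, x') := by
    intro p
    rw [sectionInteraction, ← lintegral_indicator (measurableSet_transversalSection hE p.1)]
    rfl
  simp_rw [h]
  refine Measurable.lintegral_prod_right'
    ((measurable_setLIntegral_compl_transversalSection hκ hE).indicator ?_)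
  have hm : Measurable fun q : (ℝ × ℝ) × Transversal n => (q.1.1, q.2) := by fun_prop
  exact hm hE

theorem measurableSet_slab : MeasurableSet (slab n) := by
  have h : slab n = Prod.fst ⁻¹' Set.Ioo (-Real.pi) Real.pi := rfl
  rw [h]
  exact measurable_fst measurableSet_Ioo

theorem setLIntegral_inter_slab {E : Set (CylSpace n)} (hE : MeasurableSet E)
    {f : CylSpace n → ℝ≥0∞} (hf : Measurable f) :
    ∫⁻ x in E ∩ slab n, f x
      = ∫⁻ x₁ in Set.Ioo (-Real.pi) Real.pi, ∫⁻ x' in transversalSection E x₁, f (x₁, x') := by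
  rw [setLIntegral_eq_lintegral_transversalSection (hE.inter measurableSet_slab) hf,
    ← lintegral_indicator measurableSet_Ioo]
  refine lintegral_congr fun x₁ => ?_
  by_cases hx : x₁ ∈ Set.Ioo (-Real.pi) Real.pi
  · have : transversalSection (E ∩ slab n) x₁ = transversalSection E x₁ := by
      ext x'
      exact ⟨fun h => h.1, fun h => ⟨h, hx⟩⟩
    rw [Set.indicator_of_mem hx, this]
  · have : transversalSection (E ∩ slab n) x₁ = ∅ := by
      ext x'
      exact ⟨fun h => hx h.2, fun h => h.elim⟩
    rw [Set.indicator_of_notMem hx, this]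
    simp

theorem periodicPerimeter_eq_lintegral_sectionInteraction {K : CylSpace n → ℝ}
    {κ : CylSpace n → ℝ≥0∞} (hκ : Measurable κ)
    (hκK : (fun x => ENNReal.ofReal (K x)) =ᵐ[volume] κ)
    {E : Set (CylSpace n)} (hE : MeasurableSet E) :
    periodicPerimeter K E
      = ∫⁻ x₁ in Set.Ioo (-Real.pi) Real.pi, ∫⁻ y₁, sectionInteraction κ E x₁ y₁ := by
  have h1 : ∀ x : CylSpace n, ∫⁻ y in Eᶜ, ENNReal.ofReal (K (x - y))
      = ∫⁻ y₁, ∫⁻ y' in (transversalSection E y₁)ᶜ, κ (x.1 - y₁, x.2 - y') := by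
    intro x
    have hq := (quasiMeasurePreserving_sub_left (volume : Measure (CylSpace n)) x).ae_eq_comp hκK
    exact (lintegral_congr_ae (ae_restrict_of_ae hq)).trans
      (setLIntegral_eq_lintegral_transversalSection hE.compl
        (hκ.comp (measurable_const.sub measurable_id)))
  unfold periodicPerimeter
  simp_rw [h1]
  have hmeas := measurable_setLIntegral_compl_transversalSection hκ hE
  rw [setLIntegral_inter_slab hE]
  · refine lintegral_congr fun x₁ => ?_
    unfold sectionInteraction
    refine lintegral_lintegral_swap (Measurable.aemeasurable ?_)
    have hm : Measurable fun q : Transversal n × ℝ => ((x₁, q.2), q.1) := by fun_prop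
    exact hmeas.comp hm
  · refine Measurable.lintegral_prod_right' (f := fun q : CylSpace n × ℝ =>
      ∫⁻ y' in (transversalSection E q.2)ᶜ, κ (q.1.1 - q.2, q.1.2 - y')) ?_
    have hm : Measurable fun q : CylSpace n × ℝ => ((q.1.1, q.2), q.1.2) := by fun_prop
    exact hmeas.comp hm

theorem measurableSet_cylRearrangement {E : Set (CylSpace n)} (hE : MeasurableSet E) :
    MeasurableSet (cylRearrangement E) := by
  have hv : Measurable fun x : CylSpace n => volume (transversalSection E x.1) :=
    (measurable_measure_prodMk_left hE).comp measurable_fst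
  have hr : Measurable fun x : CylSpace n => schwarzRadius (transversalSection E x.1) :=
    ((hv.div_const _).ennreal_toReal).pow_const _
  have h : cylRearrangement E = {x | volume (transversalSection E x.1) = ∞}
      ∪ ({x | volume (transversalSection E x.1) = ∞}ᶜ
        ∩ {x | ‖x.2‖ < schwarzRadius (transversalSection E x.1)}) := by
    ext x
    by_cases hx : volume (transversalSection E x.1) = ∞ <;>
      simp [cylRearrangement, schwarz, hx]
  have htop : MeasurableSet {x : CylSpace n | volume (transversalSection E x.1) = ∞} :=
    hv (measurableSet_singleton ∞)
  rw [h]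
  exact htop.union (htop.compl.inter (measurableSet_lt measurable_snd.norm hr))

theorem periodicPerimeter_congr (K : CylSpace n → ℝ) {E F : Set (CylSpace n)}
    (h : E =ᵐ[volume] F) : periodicPerimeter K E = periodicPerimeter K F := by
  unfold periodicPerimeter
  rw [setLIntegral_congr (h.inter (ae_eq_refl (slab n)))]
  exact lintegral_congr fun x => setLIntegral_congr h.compl

theorem cylRearrangement_congr {E F : Set (CylSpace n)} (h : E =ᵐ[volume] F) :
    cylRearrangement E =ᵐ[volume] cylRearrangement F := by
  have h1 : ∀ᵐ x₁ : ℝ, transversalSection E x₁ =ᵐ[volume] transversalSection F x₁ :=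
    Measure.ae_ae_of_ae_prod (p := fun x : ℝ × Transversal n => E x = F x) h
  have h2 : ∀ᵐ x : CylSpace n,
      transversalSection E x.1 =ᵐ[volume] transversalSection F x.1 :=
    Measure.quasiMeasurePreserving_fst.ae h1
  filter_upwards [h2] with x hx
  have : schwarz (transversalSection E x.1) = schwarz (transversalSection F x.1) := by
    unfold schwarz schwarzRadius
    rw [measure_congr hx]
  change (x.2 ∈ schwarz (transversalSection E x.1)) = (x.2 ∈ schwarz (transversalSection F x.1))
  rw [this]

theorem periodicPerimeter_translate (K : CylSpace n → ℝ) (c : Transversal n)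
    (E : Set (CylSpace n)) :
    periodicPerimeter K ((fun x : CylSpace n => x + ((0 : ℝ), c)) '' E)
      = periodicPerimeter K E := by
  set a : CylSpace n := ((0 : ℝ), c) with ha
  have hmp : MeasurePreserving (fun x : CylSpace n => x + a) volume volume :=
    measurePreserving_add_right volume a
  have hemb : MeasurableEmbedding (fun x : CylSpace n => x + a) :=
    (MeasurableEquiv.addRight a).measurableEmbedding
  have hpre : ∀ S : Set (CylSpace n),
      (fun x : CylSpace n => x + a) ⁻¹' ((fun x : CylSpace n => x + a) '' S) = S := fun S =>
    Set.preimage_image_eq S (add_left_injective a)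
  unfold periodicPerimeter
  rw [← hmp.setLIntegral_comp_preimage_emb hemb]
  have h1 : (fun x : CylSpace n => x + a) ⁻¹'
      ((fun x : CylSpace n => x + a) '' E ∩ slab n) = E ∩ slab n := by
    rw [Set.preimage_inter, hpre]
    congr 1
    ext x
    simp [slab, ha]
  rw [h1]
  refine lintegral_congr fun x => ?_
  rw [← hmp.setLIntegral_comp_preimage_emb hemb, Set.preimage_compl, hpre]
  simp

/-- For almost all pairs of cross sections, the measurable version `κ` of the kernel agrees with its
radial profile. -/
theorem ae_sectionInteraction_eq {K : CylSpace n → ℝ} (hKrot : RotInvariant K)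
    {κ : CylSpace n → ℝ≥0∞} (hκK : (fun x => ENNReal.ofReal (K x)) =ᵐ[volume] κ)
    [Nontrivial (Transversal n)] {e : Transversal n} (he : ‖e‖ = 1) (x₁ : ℝ) :
    ∀ᵐ y₁ : ℝ, ∀ E : Set (CylSpace n), sectionInteraction κ E x₁ y₁
      = interaction (radialProfile K e (x₁ - y₁)) (transversalSection E x₁)
        (transversalSection E y₁)ᶜ := by
  have h1 : ∀ᵐ z : ℝ, ∀ᵐ x' : Transversal n, ENNReal.ofReal (K (z, x')) = κ (z, x') :=
    Measure.ae_ae_of_ae_prod hκK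
  have h2 : ∀ᵐ y₁ : ℝ, ∀ᵐ x' : Transversal n,
      ENNReal.ofReal (K (x₁ - y₁, x')) = κ (x₁ - y₁, x') :=
    (quasiMeasurePreserving_sub_left volume x₁).ae h1
  filter_upwards [h2] with y₁ hy E
  have h0 : ∀ᵐ x' : Transversal n, x' ≠ 0 := by simp [ae_iff]
  have h3 : ∀ᵐ x' : Transversal n,
      κ (x₁ - y₁, x') = radialProfile K e (x₁ - y₁) ‖x'‖ := by
    filter_upwards [hy, h0] with x' hx' hx0
    rw [← hx', radialProfile_norm hKrot he _ hx0]
  refine lintegral_congr fun x' => lintegral_congr_ae (ae_restrict_of_ae ?_)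
  exact (quasiMeasurePreserving_sub_left volume x').ae h3

theorem ae_volume_transversalSection_ne_top {E : Set (CylSpace n)} (hE : MeasurableSet E)
    (hEfin : volume (E ∩ slab n) < ∞) :
    ∀ᵐ x₁ ∂(volume.restrict (Set.Ioo (-Real.pi) Real.pi)),
      volume (transversalSection E x₁) ≠ ∞ := by
  have h := setLIntegral_inter_slab hE (f := fun _ => 1) measurable_const
  simp only [setLIntegral_const, one_mul] at h
  rw [h] at hEfin
  exact (ae_lt_top (measurable_measure_prodMk_left hE) hEfin.ne).mono fun _ hx => hx.ne

/-- For a measurable set, the rearrangement inequality holds for almost every pair of cross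
sections. -/
theorem ae_ae_sectionInteraction_cylRearrangement_le (hn : 2 ≤ n) {K : CylSpace n → ℝ}
    (hKpos : ∀ x, 0 < K x) (hKrot : RotInvariant K) (hKdec : RadiallyDecreasing K)
    (hKint : ∀ x₁ : ℝ, x₁ ≠ 0 → Integrable (fun x' : Transversal n => K (x₁, x')) volume)
    {κ : CylSpace n → ℝ≥0∞} (hκK : (fun x => ENNReal.ofReal (K x)) =ᵐ[volume] κ)
    {E : Set (CylSpace n)} (hE : MeasurableSet E) (x₁ : ℝ)
    (hx₁ : volume (transversalSection E x₁) ≠ ∞) :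
    ∀ᵐ y₁ : ℝ, sectionInteraction κ (cylRearrangement E) x₁ y₁ ≤ sectionInteraction κ E x₁ y₁ ∧
      (sectionInteraction κ (cylRearrangement E) x₁ y₁ = sectionInteraction κ E x₁ y₁ →
        volume (transversalSection E x₁) ≠ 0 → volume (transversalSection E y₁) ≠ 0 →
        (volume (transversalSection E y₁) = ∞ ∧ transversalSection E y₁ =ᵐ[volume] Set.univ) ∨
          volume (transversalSection E y₁) ≠ ∞ ∧ ∃ c,
            transversalSection E x₁
              =ᵐ[volume] Metric.ball c (schwarzRadius (transversalSection E x₁)) ∧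
            transversalSection E y₁
              =ᵐ[volume] Metric.ball c (schwarzRadius (transversalSection E y₁))) := by
  have : NeZero (n - 1) := ⟨by omega⟩
  obtain ⟨e, he⟩ : ∃ e : Transversal n, ‖e‖ = 1 := exists_norm_eq _ zero_le_one
  have hne : ∀ᵐ y₁ : ℝ, y₁ ≠ x₁ := by simp [ae_iff]
  filter_upwards [ae_sectionInteraction_eq hKrot hκK he x₁, hne] with y₁ hy hyx
  have hz : x₁ - y₁ ≠ 0 := sub_ne_zero.2 hyx.symm
  have hg := antitone_radialProfile hKpos hKdec he (x₁ - y₁)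
  have hgs := strictAntiOn_radialProfile hKpos hKdec he (x₁ - y₁)
  have hint : ∫⁻ x : Transversal n, radialProfile K e (x₁ - y₁) ‖x‖ ≠ ∞ := by
    have h0 : ∀ᵐ x' : Transversal n, x' ≠ 0 := by simp [ae_iff]
    rw [lintegral_congr_ae (h0.mono fun x hx => radialProfile_norm hKrot he _ hx)]
    exact (hKint _ hz).lintegral_lt_top.ne
  rw [hy, hy]
  have hA := measurableSet_transversalSection hE x₁
  have hB := measurableSet_transversalSection hE y₁
  exact ⟨interaction_schwarz_compl_le hg hint hA hB hx₁, fun heq hA0 hB0 =>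
    ae_eq_univ_or_exists_ae_eq_ball hg hgs hint hA hB hx₁ hA0 hB0 heq⟩

end Slicing

/-! ### Rearrangement of the whole set -/

section Main

variable {n : ℕ}

theorem periodicPerimeter_cylRearrangement_le (hn : 2 ≤ n) {K : CylSpace n → ℝ}
    (hKpos : ∀ x, 0 < K x) (hKmeas : AEMeasurable K volume)
    (hKrot : RotInvariant K) (hKdec : RadiallyDecreasing K)
    (hKint : ∀ x₁ : ℝ, x₁ ≠ 0 → Integrable (fun x' : Transversal n => K (x₁, x')) volume)
    {E : Set (CylSpace n)} (hE : MeasurableSet E) (hEfin : volume (E ∩ slab n) < ∞) :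
    periodicPerimeter K (cylRearrangement E) ≤ periodicPerimeter K E := by
  have hκ := hKmeas.ennreal_ofReal.measurable_mk
  have hκK := hKmeas.ennreal_ofReal.ae_eq_mk
  rw [periodicPerimeter_eq_lintegral_sectionInteraction hκ hκK hE,
    periodicPerimeter_eq_lintegral_sectionInteraction hκ hκK (measurableSet_cylRearrangement hE)]
  refine lintegral_mono_ae ?_
  filter_upwards [ae_volume_transversalSection_ne_top hE hEfin] with x₁ hx₁
  refine lintegral_mono_ae ?_
  filter_upwards [ae_ae_sectionInteraction_cylRearrangement_le hn hKpos hKrot hKdec hKint hκK hE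
    x₁ hx₁] with y₁ hy using hy.1

theorem mem_image_add_cylRearrangement {E : Set (CylSpace n)} {c : Transversal n}
    {x : CylSpace n} :
    x ∈ (fun x : CylSpace n => x + ((0 : ℝ), c)) '' cylRearrangement E
      ↔ x.2 - c ∈ schwarz (transversalSection E x.1) := by
  rw [Set.image_add_right, Set.mem_preimage]
  simp [cylRearrangement, sub_eq_add_neg]

theorem exists_translate_of_periodicPerimeter_eq (hn : 2 ≤ n) {K : CylSpace n → ℝ}
    (hKpos : ∀ x, 0 < K x) (hKmeas : AEMeasurable K volume)
    (hKrot : RotInvariant K) (hKdec : RadiallyDecreasing K)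
    (hKint : ∀ x₁ : ℝ, x₁ ≠ 0 → Integrable (fun x' : Transversal n => K (x₁, x')) volume)
    {E : Set (CylSpace n)} (hE : MeasurableSet E) (hEfin : volume (E ∩ slab n) < ∞)
    (hE0 : volume (E ∩ slab n) ≠ 0) (hP : periodicPerimeter K E ≠ ∞)
    (heq : periodicPerimeter K (cylRearrangement E) = periodicPerimeter K E) :
    ∃ c : Transversal n,
      E =ᵐ[volume] (fun x : CylSpace n => x + ((0 : ℝ), c)) '' cylRearrangement E := by
  have : NeZero (n - 1) := ⟨by omega⟩
  have hE' := measurableSet_cylRearrangement hE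
  have hκ := hKmeas.ennreal_ofReal.measurable_mk
  have hκK := hKmeas.ennreal_ofReal.ae_eq_mk
  set κ := hKmeas.ennreal_ofReal.mk
  have hI := measurable_sectionInteraction hκ hE
  rw [periodicPerimeter_eq_lintegral_sectionInteraction hκ hκK hE] at hP heq
  rw [periodicPerimeter_eq_lintegral_sectionInteraction hκ hκK hE'] at heq
  have hslices := ae_volume_transversalSection_ne_top hE hEfin
  have hcomp := fun x₁ hx₁ => ae_ae_sectionInteraction_cylRearrangement_le hn hKpos hKrot hKdec
    hKint hκK hE x₁ hx₁
  -- equality of the integrals forces equality of almost all contributions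
  have hle : ∀ᵐ x₁ ∂(volume.restrict (Set.Ioo (-Real.pi) Real.pi)),
      ∫⁻ y₁, sectionInteraction κ (cylRearrangement E) x₁ y₁
        ≤ ∫⁻ y₁, sectionInteraction κ E x₁ y₁ := by
    filter_upwards [hslices] with x₁ hx₁
    exact lintegral_mono_ae ((hcomp x₁ hx₁).mono fun _ h => h.1)
  have heq1 := ae_eq_of_ae_le_of_lintegral_le hle (heq ▸ hP)
    hI.lintegral_prod_right'.aemeasurable heq.ge
  have hfin := ae_lt_top hI.lintegral_prod_right' hP
  -- a nontrivial cross section in the slab determines the center of all the other ones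
  obtain ⟨x₁, hx₁0, hx₁fin, hx₁eq, hx₁lt⟩ : ∃ x₁ : ℝ, volume (transversalSection E x₁) ≠ 0 ∧
      volume (transversalSection E x₁) ≠ ∞ ∧
      ∫⁻ y₁, sectionInteraction κ (cylRearrangement E) x₁ y₁
        = ∫⁻ y₁, sectionInteraction κ E x₁ y₁ ∧
      ∫⁻ y₁, sectionInteraction κ E x₁ y₁ < ∞ := by
    by_contra! hcon
    refine hE0 ?_
    have h := setLIntegral_inter_slab hE (f := fun _ => 1) measurable_const
    simp only [setLIntegral_const, one_mul] at h
    have hm : Measurable fun x₁ => volume (transversalSection E x₁) :=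
      measurable_measure_prodMk_left hE
    rw [h, lintegral_eq_zero_iff hm]
    filter_upwards [hslices, heq1, hfin] with x₁ h1 h2 h3
    by_contra h0
    exact absurd h3 (not_lt.2 (hcon x₁ h0 h1 h2))
  have heq2 : ∀ᵐ y₁ : ℝ, sectionInteraction κ (cylRearrangement E) x₁ y₁
      = sectionInteraction κ E x₁ y₁ :=
    ae_eq_of_ae_le_of_lintegral_le ((hcomp x₁ hx₁fin).mono fun _ h => h.1)
      (hx₁eq ▸ hx₁lt.ne) (hI.comp measurable_prodMk_left).aemeasurable hx₁eq.ge
  obtain ⟨c, hc⟩ : ∃ c : Transversal n, ∀ c', transversalSection E x₁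
      =ᵐ[volume] Metric.ball c' (schwarzRadius (transversalSection E x₁)) → c' = c := by
    by_cases h : ∃ c : Transversal n, transversalSection E x₁
      =ᵐ[volume] Metric.ball c (schwarzRadius (transversalSection E x₁))
    · obtain ⟨c, hc⟩ := h
      exact ⟨c, fun c' hc' => eq_of_ae_eq_ball hx₁fin hx₁0 hc' hc⟩
    · exact ⟨0, fun c' hc' => absurd ⟨c', hc'⟩ h⟩
  refine ⟨c, ?_⟩
  have hsec : ∀ᵐ y₁ : ℝ, ∀ᵐ y' : Transversal n,
      (y₁, y') ∈ E ↔ y' - c ∈ schwarz (transversalSection E y₁) := by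
    filter_upwards [hcomp x₁ hx₁fin, heq2] with y₁ h1 h2
    by_cases hy0 : volume (transversalSection E y₁) = 0
    · have hs : schwarz (transversalSection E y₁) = ∅ := by
        rw [schwarz_of_volume_ne_top (by simp [hy0]), schwarzRadius, hy0, ENNReal.zero_div,
          ENNReal.toReal_zero, Real.zero_rpow, Metric.ball_zero]
        exact one_div_ne_zero (Nat.cast_ne_zero.2 (NeZero.ne _))
      rw [hs]
      filter_upwards [measure_eq_zero_iff_ae_notMem.1 hy0] with y' hy'
      exact ⟨fun h => hy' h, fun h => h.elim⟩
    · rcases h1.2 h2 hx₁0 hy0 with ⟨hv, h⟩ | ⟨hv, c', hc', h⟩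
      · have hs : schwarz (transversalSection E y₁) = Set.univ := if_pos hv
        rw [hs]
        filter_upwards [h.mem_iff] with y' hy'
        exact ⟨fun _ => trivial, fun _ => hy'.2 trivial⟩
      · rw [schwarz_of_volume_ne_top hv]
        rw [hc c' hc'] at h
        filter_upwards [h.mem_iff] with y' hy'
        rw [mem_ball_zero_iff, ← mem_ball_iff_norm]
        exact hy'
  have hm : MeasurableSet {x : ℝ × Transversal n |
      x ∈ E ↔ x ∈ (fun x : CylSpace n => x + ((0 : ℝ), c)) '' cylRearrangement E} := by
    refine MeasurableSet.iff hE ?_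
    rw [Set.image_add_right]
    exact (measurable_add_const _) hE'
  refine Filter.eventuallyEq_set.2 ((Measure.ae_prod_iff_ae_ae hm).2 ?_)
  filter_upwards [hsec] with y₁ h1
  filter_upwards [h1] with y' h2
  rw [mem_image_add_cylRearrangement]
  exact h2

end Main

theorem lemma1p2 (n : ℕ) (hn : 2 ≤ n) (K : CylSpace n → ℝ)
    (hKpos : ∀ x, 0 < K x) (hKmeas : AEMeasurable K volume)
    (hKrot : RotInvariant K) (hKdec : RadiallyDecreasing K)
    (hKint : ∀ x₁ : ℝ, x₁ ≠ 0 → Integrable (fun x' : Transversal n => K (x₁, x')) volume)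
    (E : Set (CylSpace n)) (hE : NullMeasurableSet E volume)
    (hEfin : volume (E ∩ slab n) < ∞) :
    periodicPerimeter K (cylRearrangement E) ≤ periodicPerimeter K E ∧
    (0 < volume (E ∩ slab n) → periodicPerimeter K E < ∞ →
      (periodicPerimeter K (cylRearrangement E) = periodicPerimeter K E ↔
        ∃ c : Transversal n,
          E =ᵐ[volume] (fun x : CylSpace n => x + ((0 : ℝ), c)) '' cylRearrangement E)) := by
  obtain ⟨F, hF, hEF⟩ : ∃ F, MeasurableSet F ∧ E =ᵐ[volume] F :=
    ⟨toMeasurable volume E, measurableSet_toMeasurable _ _, hE.toMeasurable_ae_eq.symm⟩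
  have hEF' := cylRearrangement_congr hEF
  have hslab : volume (E ∩ slab n) = volume (F ∩ slab n) :=
    measure_congr (hEF.inter (ae_eq_refl _))
  have hP := periodicPerimeter_congr K hEF
  have hP' := periodicPerimeter_congr K hEF'
  refine ⟨?_, fun hpos hPfin => ⟨fun heq => ?_, ?_⟩⟩
  · rw [hP, hP']
    exact periodicPerimeter_cylRearrangement_le hn hKpos hKmeas hKrot hKdec hKint hF
      (hslab ▸ hEfin)
  · rw [hP, hP'] at heq
    obtain ⟨c, hc⟩ := exists_translate_of_periodicPerimeter_eq hn hKpos hKmeas hKrot hKdec hKint hF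
      (hslab ▸ hEfin) (hslab ▸ hpos.ne') (hP ▸ hPfin.ne) heq
    refine ⟨c, hEF.trans (hc.trans ?_)⟩
    rw [Set.image_add_right, Set.image_add_right]
    exact (measurePreserving_add_right (volume : Measure (CylSpace n))
      (-((0 : ℝ), c))).quasiMeasurePreserving.preimage_ae_eq hEF'.symm
  · rintro ⟨c, hc⟩
    rw [periodicPerimeter_congr K hc, periodicPerimeter_translate]
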